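/- All graphs are finite, simple and undirected. The Euler genus of the surface with $h$ handles and $c$ crosscaps is $2h+c$, and the Euler genus of a graph $G$ is the minimum Euler genus of a surface in which $G$ embeds without crossings. The radius of $G$ is $\min_{u\in V(G)}\max_{v\in V(G)}\mathrm{dist}_G(u,v)$. The $n\times n$ grid is the graph with vertex-set $\{1,\dots,n\}^2$ in which $(x_1,y_1)$ and $(x_2,y_2)$ are adjacent if and only if $|x_1-x_2|+|y_1-y_2|=1$. Let $g\ge 0$ and $r\ge 1$ be integers, and let $n:=\lceil 4r(1+\sqrt{2g+2})\,\rceil$. Then no graph with Euler genus $g$ and radius $r$ contains the $n\times n$ grid as a minor. -/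

import Mathlib

namespace SurfaceGrid

/-- The `n × m` grid: two vertices are adjacent iff `|x₁ - x₂| + |y₁ - y₂| = 1`. -/
def grid (n m : ℕ) : SimpleGraph (Fin n × Fin m) where
  Adj a b := |((a.1 : ℕ) : ℤ) - ((b.1 : ℕ) : ℤ)| + |((a.2 : ℕ) : ℤ) - ((b.2 : ℕ) : ℤ)| = 1
  symm := ⟨fun a b h => by
    rw [abs_sub_comm, add_comm, abs_sub_comm, add_comm]; exact h⟩
  loopless := ⟨fun a h => by simp at h⟩

/-- `H` is a minor of `G`: there is an `H`-model in `G`, that is, a family of pairwise disjoint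
(nonempty) connected pieces `B u` of `G`, one for each vertex `u` of `H`, such that for every edge
`uv` of `H` there is an edge of `G` between `B u` and `B v`. -/
def IsMinor {U V : Type*} (H : SimpleGraph U) (G : SimpleGraph V) : Prop :=
  ∃ B : U → Set V,
    (∀ u, (G.induce (B u)).Connected) ∧
    (∀ u v, u ≠ v → Disjoint (B u) (B v)) ∧
    ∀ u v, H.Adj u v → ∃ x ∈ B u, ∃ y ∈ B v, G.Adj x y

/-! ### Triangulated closed surfaces

A pure 2-dimensional simplicial complex on the vertex set `W` is given by its set `T` of
triangles. -/

section Surface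

variable {W : Type*} [DecidableEq W]

/-- The edges (1-simplices) of the complex: all 2-element subsets of the triangles. -/
def edges (T : Finset (Finset W)) : Finset (Finset W) :=
  T.biUnion (Finset.powersetCard 2)

/-- The 1-skeleton of the complex, as a graph. -/
def skeleton (T : Finset (Finset W)) : SimpleGraph W where
  Adj u v := u ≠ v ∧ {u, v} ∈ edges T
  symm := ⟨fun u v h => ⟨h.1.symm, by rw [Finset.pair_comm]; exact h.2⟩⟩
  loopless := ⟨fun _ h => h.1 rfl⟩

/-- The link of the vertex `v`: two vertices are adjacent in it iff they span a triangle
together with `v`. -/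
def link (T : Finset (Finset W)) (v : W) : SimpleGraph W where
  Adj x y := x ≠ y ∧ {v, x, y} ∈ T
  symm := ⟨fun x y h => ⟨h.1.symm, by rw [Finset.pair_comm]; exact h.2⟩⟩
  loopless := ⟨fun _ h => h.1 rfl⟩

/-- The simplicial complex with vertex set `W` and set of triangles `T` is a triangulation of a
closed connected surface. As every edge is in exactly two triangles, every link is 2-regular, so
that the last field says that the link of every vertex is a single cycle. -/
structure IsClosedSurface (T : Finset (Finset W)) : Prop where
  card_triangle : ∀ t ∈ T, t.card = 3
  connected : (skeleton T).Connected
  exists_triangle : ∀ v : W, ∃ t ∈ T, v ∈ t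
  two_triangles : ∀ e ∈ edges T, (T.filter (fun t => e ⊆ t)).card = 2
  link_connected : ∀ v x y : W,
    (skeleton T).Adj v x → (skeleton T).Adj v y → (link T v).Reachable x y

/-- The Euler characteristic `#vertices - #edges + #triangles`. -/
def eulerChar [Fintype W] (T : Finset (Finset W)) : ℤ :=
  (Fintype.card W : ℤ) - ((edges T).card : ℤ) + (T.card : ℤ)

/-- The Euler genus of a closed connected surface is `2 - χ`, which equals `2h + c` for the
sphere with `h` handles and `c` crosscaps. -/
def surfaceEulerGenus [Fintype W] (T : Finset (Finset W)) : ℤ := 2 - eulerChar T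

end Surface

/-- `G` can be drawn in the 1-skeleton `S` without crossings: the vertices of `G` are sent to
distinct vertices of `S`, and the edges of `G` to simple paths of `S` (polygonal arcs) between the
images of their ends, such that no path passes through the image of a further vertex of `G`, and
the paths of two distinct edges meet only in images of vertices of `G`, hence only in the images of
common ends. -/
def DrawsIn {V W : Type*} (G : SimpleGraph V) (S : SimpleGraph W) : Prop :=
  ∃ (f : V ↪ W) (P : ∀ ⦃u v : V⦄, G.Adj u v → S.Walk (f u) (f v)),
    (∀ ⦃u v : V⦄ (h : G.Adj u v), (P h).IsPath) ∧
    (∀ ⦃u v : V⦄ (h : G.Adj u v), P h.symm = (P h).reverse) ∧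
    (∀ ⦃u v : V⦄ (h : G.Adj u v) (w : V), f w ∈ (P h).support → w = u ∨ w = v) ∧
    (∀ ⦃u v u' v' : V⦄ (h : G.Adj u v) (h' : G.Adj u' v'), s(u, v) ≠ s(u', v') →
      ∀ x, x ∈ (P h).support → x ∈ (P h').support → ∃ w, x = f w)

/-- `G` embeds without crossings in some closed connected surface of Euler genus `k`: in a suitable
triangulation of the surface, `G` is drawn along the edges of the triangulation. -/
def EmbedsInSurfaceOfEulerGenus {V : Type*} (G : SimpleGraph V) (k : ℕ) : Prop :=
  ∃ (N : ℕ) (T : Finset (Finset (Fin N))),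
    IsClosedSurface T ∧ surfaceEulerGenus T = (k : ℤ) ∧ DrawsIn G (skeleton T)

/-- The Euler genus of a graph: the minimum Euler genus of a surface in which it embeds without
crossings (`⊤` if there is none). -/
noncomputable def eulerGenus {V : Type*} (G : SimpleGraph V) : ℕ∞ :=
  ⨅ (k : ℕ) (_ : EmbedsInSurfaceOfEulerGenus G k), (k : ℕ∞)

end SurfaceGrid

namespace SurfaceGrid

/-! ### Chains modulo two on a triangulated surface -/

section Chains

variable {W : Type*} [DecidableEq W] {T : Finset (Finset W)}

/-! Chains are taken modulo two on the triangulated surface. Its first homology has dimension at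
most the Euler genus (`IsClosedSurface.finrank_cycles_le`).

Let `z` be a centre of `G`. Since `G` is connected, the branch sets of the grid can be enlarged to a
partition of its vertices (`exists_partition_of_model`). The graph `H` of all adjacencies between
parts contains the grid and is a minor of the 1-skeleton. The grid has more than 2g+2 disjoint
blocks of side 4r; a block that contains `z` is discarded. A walk of length at most r leads from the
middle of any other block to `z`. If the distance from the middle, measured in the grid, grew by at
most one per step, then `z` would lie in the block. So some edge of the walk jumps over a concentric
ring of the block (`exists_jump`).

A jump obstructs null-homology. Suppose that every 4-cycle inside the block bounds a 2-chain,
normalised to vanish away from that 4-cycle. The sum of these 2-chains over the faces within the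
ring is 0 near every vertex outside the ring and 1 near every vertex strictly inside it
(`GridModel.nearEq_four_faces`). A triangle on the jumping edge would then have both coefficients.

The argument survives modulo cycles of other blocks, as long as the jump does not end inside those.
Hence, if the blocks of `J` are ordered so that no jump ends inside a later block of `J`, their face
spaces successively enlarge the homology, and `J` has at most g elements
(`GridModel.card_blocks_le`). The blocks whose jump does not end in a later block satisfy this, and
the remaining ones do for the reversed order. So at most 2g blocks are left, but there are at least
2g+2. -/

theorem chain_add_self {α : Type*} (x : α → ZMod 2) : x + x = 0 :=
  funext fun a => CharTwo.add_self_eq_zero (x a)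

/-- The boundary map from 2-chains to 1-chains modulo two. -/
def bdry₂ (T : Finset (Finset W)) : (T → ZMod 2) →ₗ[ZMod 2] (edges T → ZMod 2) where
  toFun f e := ∑ t : T, if e.1 ⊆ t.1 then f t else 0
  map_add' f g := by
    ext e
    simp only [Pi.add_apply, ← Finset.sum_add_distrib]
    exact Finset.sum_congr rfl fun t _ => by split_ifs <;> simp
  map_smul' c f := by
    ext e
    simp [Finset.mul_sum]

/-- The boundary map from 1-chains to 0-chains modulo two. -/
def bdry₁ (T : Finset (Finset W)) : (edges T → ZMod 2) →ₗ[ZMod 2] (W → ZMod 2) where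
  toFun c v := ∑ e : edges T, if v ∈ e.1 then c e else 0
  map_add' f g := by
    ext e
    simp only [Pi.add_apply, ← Finset.sum_add_distrib]
    exact Finset.sum_congr rfl fun t _ => by split_ifs <;> simp
  map_smul' c f := by
    ext e
    simp [Finset.mul_sum]

theorem bdry₂_apply (f : T → ZMod 2) (e : edges T) :
    bdry₂ T f e = ∑ t : T, if e.1 ⊆ t.1 then f t else 0 := rfl

theorem bdry₁_apply (c : edges T → ZMod 2) (v : W) :
    bdry₁ T c v = ∑ e : edges T, if v ∈ e.1 then c e else 0 := rfl

theorem mem_edges {e : Finset W} : e ∈ edges T ↔ ∃ t ∈ T, e ⊆ t ∧ e.card = 2 := by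
  simp [edges, Finset.mem_powersetCard]

theorem card_of_mem_edges {e : Finset W} (he : e ∈ edges T) : e.card = 2 := by
  obtain ⟨t, -, -, h⟩ := mem_edges.1 he
  exact h

/-- This is how closedness enters: the coefficient of a boundary at an edge compares the two sides
of that edge. -/
theorem IsClosedSurface.exists_cofaces (hT : IsClosedSurface T) (e : edges T) :
    ∃ t t' : T, e.1 ⊆ t.1 ∧ e.1 ⊆ t'.1 ∧ (∀ s : T, e.1 ⊆ s.1 → s = t ∨ s = t') ∧
      ∀ f : T → ZMod 2, bdry₂ T f e = f t + f t' := by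
  obtain ⟨t, t', hne, h⟩ := Finset.card_eq_two.1 (hT.two_triangles e.1 e.2)
  have key : ∀ s, s ∈ T ∧ e.1 ⊆ s ↔ s = t ∨ s = t' := by
    intro s
    have := congrArg (s ∈ ·) h
    simpa using this
  have ht := (key t).2 (Or.inl rfl)
  have ht' := (key t').2 (Or.inr rfl)
  refine ⟨⟨t, ht.1⟩, ⟨t', ht'.1⟩, ht.2, ht'.2, ?_, ?_⟩
  · intro s hs
    rcases (key s.1).1 ⟨s.2, hs⟩ with h | h
    · exact Or.inl (Subtype.ext h)
    · exact Or.inr (Subtype.ext h)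
  · intro f
    rw [bdry₂_apply, ← Finset.sum_filter]
    have : (Finset.univ.filter fun s : T => e.1 ⊆ s.1) = {⟨t, ht.1⟩, ⟨t', ht'.1⟩} := by
      ext s
      have := key s.1
      simp only [Finset.mem_filter, Finset.mem_univ, true_and, Finset.mem_insert,
        Finset.mem_singleton, Subtype.ext_iff]
      rw [← this]
      simp
    rw [this, Finset.sum_pair]
    simpa [Subtype.ext_iff] using hne

theorem IsClosedSurface.eq_of_bdry₂_eq_zero (hT : IsClosedSurface T) {f : T → ZMod 2}
    {e : edges T} (h : bdry₂ T f e = 0) {s s' : T} (hs : e.1 ⊆ s.1) (hs' : e.1 ⊆ s'.1) :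
    f s = f s' := by
  obtain ⟨t, t', -, -, hall, hf⟩ := hT.exists_cofaces e
  rw [hf, CharTwo.add_eq_zero] at h
  rcases hall s hs with rfl | rfl <;> rcases hall s' hs' with rfl | rfl <;> simp [h]

/-- All the triangles that meet `X` have the same coefficient `α` in `f`. -/
def NearEq (f : T → ZMod 2) (X : Set W) (α : ZMod 2) : Prop :=
  ∀ t : T, ∀ v ∈ t.1, v ∈ X → f t = α

/-- The link of `v` is connected, and a walk in it passes from triangle to triangle through edges at
`v`, where `f` has no boundary and so does not change. -/
theorem IsClosedSurface.eq_of_mem_of_mem (hT : IsClosedSurface T) {f : T → ZMod 2} {v : W}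
    (hf : ∀ e : edges T, v ∈ e.1 → bdry₂ T f e = 0) {t t' : T} (ht : v ∈ t.1) (ht' : v ∈ t'.1) :
    f t = f t' := by
  have hedge : ∀ (t : T), v ∈ t.1 → ∀ x ∈ t.1, x ≠ v → {v, x} ∈ edges T := by
    intro t ht x hx hne
    refine mem_edges.2 ⟨t.1, t.2, ?_, Finset.card_pair hne.symm⟩
    intro y hy
    simp only [Finset.mem_insert, Finset.mem_singleton] at hy
    rcases hy with rfl | rfl <;> assumption
  have hother : ∀ (t : T), v ∈ t.1 → ∃ x ∈ t.1, x ≠ v := by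
    intro t ht
    exact Finset.exists_mem_ne (by rw [hT.card_triangle t.1 t.2]; norm_num) v
  have hstar : ∀ x y, (link T v).Reachable x y → ∀ t t' : T, v ∈ t.1 → v ∈ t'.1 →
      x ∈ t.1 → x ≠ v → y ∈ t'.1 → y ≠ v → f t = f t' := by
    rintro x y ⟨p⟩
    induction p with
    | nil =>
      intro t t' h1 h2 h3 h4 h5 h6
      refine hT.eq_of_bdry₂_eq_zero (hf ⟨_, hedge t h1 _ h3 h4⟩ (by simp)) ?_ ?_ <;>
      · intro z hz
        simp only [Finset.mem_insert, Finset.mem_singleton] at hz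
        rcases hz with rfl | rfl <;> assumption
    | @cons x x' y hadj p ih =>
      intro t t' h1 h2 h3 h4 h5 h6
      have hx' : x' ≠ v := by
        rintro rfl
        -- If `x' = v`, the triangle spanned by this link edge would have only two vertices.
        have := hT.card_triangle _ hadj.2
        have h2 : ({x', x, x'} : Finset W) ⊆ {x', x} := by
          intro z; simp; tauto
        have := Finset.card_le_card h2
        have := Finset.card_le_two (a := x') (b := x)
        omega
      rw [← ih ⟨_, hadj.2⟩ t' (by simp) h2 (by simp) hx' h5 h6]
      refine hT.eq_of_bdry₂_eq_zero (hf ⟨_, hedge t h1 _ h3 h4⟩ (by simp)) ?_ ?_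
      · intro z hz
        simp only [Finset.mem_insert, Finset.mem_singleton] at hz
        rcases hz with rfl | rfl <;> assumption
      · intro z hz
        simp only [Finset.mem_insert, Finset.mem_singleton] at hz ⊢
        tauto
  obtain ⟨x, hx, hxv⟩ := hother t ht
  obtain ⟨y, hy, hyv⟩ := hother t' ht'
  exact hstar x y (hT.link_connected v x y ⟨hxv.symm, hedge t ht x hx hxv⟩
    ⟨hyv.symm, hedge t' ht' y hy hyv⟩) t t' ht ht' hx hxv hy hyv

/-- A 2-chain whose boundary misses a connected set of vertices is constant near that set. -/
theorem IsClosedSurface.exists_nearEq (hT : IsClosedSurface T) {f : T → ZMod 2} {X : Set W}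
    (hX : ((skeleton T).induce X).Preconnected)
    (hf : ∀ e : edges T, ∀ v ∈ e.1, v ∈ X → bdry₂ T f e = 0) : ∃ α, NearEq f X α := by
  have hreach : ∀ x y : X, ((skeleton T).induce X).Reachable x y → ∀ t t' : T, x.1 ∈ t.1 →
      y.1 ∈ t'.1 → f t = f t' := by
    rintro x y ⟨p⟩
    induction p with
    | nil =>
      intro t t' h1 h2
      exact hT.eq_of_mem_of_mem (fun e he => hf e _ he (Subtype.coe_prop _)) h1 h2
    | @cons x x' y hadj p ih =>
      intro t t' h1 h2
      have h := hadj.2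
      obtain ⟨s, hs, hes, -⟩ := mem_edges.1 h
      have h3 := hT.eq_of_mem_of_mem (fun e he => hf e _ he x.2) h1
        (t' := ⟨s, hs⟩) (hes (by simp))
      exact h3.trans (ih ⟨s, hs⟩ t' (hes (by simp)) h2)
  by_cases h : ∃ t : T, ∃ v ∈ t.1, v ∈ X
  · obtain ⟨t, v, hv, hvX⟩ := h
    exact ⟨f t, fun t' v' hv' hvX' => hreach ⟨v', hvX'⟩ ⟨v, hvX⟩ (hX _ _) t' t hv' hv⟩
  · exact ⟨0, fun t v hv hvX => absurd ⟨t, v, hv, hvX⟩ h⟩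

/-- Each vertex of a triangle lies in exactly two of its edges. -/
theorem IsClosedSurface.bdry₁_bdry₂ (hT : IsClosedSurface T) (f : T → ZMod 2) :
    bdry₁ T (bdry₂ T f) = 0 := by
  ext v
  have h : ∀ t : T, (∑ e : edges T, if v ∈ e.1 ∧ e.1 ⊆ t.1 then f t else 0) = 0 := by
    intro t
    rw [← Finset.sum_filter, Finset.sum_const]
    by_cases hv : v ∈ t.1
    · have hcard : (Finset.univ.filter fun e : edges T => v ∈ e.1 ∧ e.1 ⊆ t.1).card = 2 := by
        have h3 := hT.card_triangle t.1 t.2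
        have : (Finset.univ.filter fun e : edges T => v ∈ e.1 ∧ e.1 ⊆ t.1).card
            = (t.1.erase v).card := by
          symm
          refine Finset.card_bij (fun x hx => ⟨{v, x}, mem_edges.2 ⟨t.1, t.2, ?_, ?_⟩⟩) ?_ ?_ ?_
          · intro z hz
            simp only [Finset.mem_insert, Finset.mem_singleton] at hz
            rcases hz with rfl | rfl
            · exact hv
            · exact Finset.mem_of_mem_erase hx
          · exact Finset.card_pair (Finset.ne_of_mem_erase hx).symm
          · intro x hx
            simp only [Finset.mem_filter, Finset.mem_univ, true_and]
            refine ⟨by simp, ?_⟩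
            intro z hz
            simp only [Finset.mem_insert, Finset.mem_singleton] at hz
            rcases hz with rfl | rfl
            · exact hv
            · exact Finset.mem_of_mem_erase hx
          · intro x hx y hy hxy
            have h1 : ({v, x} : Finset W) = {v, y} := congrArg Subtype.val hxy
            have h2 : x ∈ ({v, y} : Finset W) := h1 ▸ (by simp)
            simp only [Finset.mem_insert, Finset.mem_singleton] at h2
            exact h2.resolve_left (Finset.ne_of_mem_erase hx)
          · rintro ⟨e, he⟩ h
            simp only [Finset.mem_filter, Finset.mem_univ, true_and] at h
            obtain ⟨x, hx⟩ : ∃ x, e.erase v = {x} := by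
              rw [← Finset.card_eq_one, Finset.card_erase_of_mem h.1, card_of_mem_edges he]
            have hxe : x ∈ e.erase v := by rw [hx]; simp
            refine ⟨x, Finset.mem_erase.2 ⟨Finset.ne_of_mem_erase hxe,
              h.2 (Finset.mem_of_mem_erase hxe)⟩, Subtype.ext ?_⟩
            change insert v {x} = e
            rw [← hx, Finset.insert_erase h.1]
        rw [this, Finset.card_erase_of_mem hv, h3]
      rw [hcard, two_nsmul, CharTwo.add_self_eq_zero]
    · rw [Finset.filter_false_of_mem]
      · simp
      · rintro e - ⟨h1, h2⟩
        exact hv (h2 h1)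
  rw [bdry₁_apply]
  calc ∑ e : edges T, (if v ∈ e.1 then bdry₂ T f e else 0)
      = ∑ e : edges T, ∑ t : T, if v ∈ e.1 ∧ e.1 ⊆ t.1 then f t else 0 := by
        refine Finset.sum_congr rfl fun e _ => ?_
        by_cases hv : v ∈ e.1 <;> simp [hv, bdry₂_apply]
    _ = 0 := by
        rw [Finset.sum_comm]
        exact Finset.sum_eq_zero fun t _ => h t

/-- A 1-cycle cannot have exactly one edge in a cut. -/
theorem eq_zero_of_cut [Finite W] {c : edges T → ZMod 2} (hc : bdry₁ T c = 0) (X : Set W)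
    (ε : edges T) (hε : ∃ v ∈ ε.1, v ∈ X) (hε' : ∃ v ∈ ε.1, v ∉ X)
    (h : ∀ e : edges T, e ≠ ε → (∃ v ∈ e.1, v ∈ X) → (∃ v ∈ e.1, v ∉ X) → c e = 0) : c ε = 0 := by
  have hX : X.Finite := X.toFinite
  have hle : ∀ e : edges T, (e.1 ∩ hX.toFinset).card ≤ 2 := fun e =>
    (Finset.card_le_card Finset.inter_subset_left).trans (card_of_mem_edges e.2).le
  have hmem : ∀ e : edges T, (∃ v ∈ e.1, v ∈ X) → 0 < (e.1 ∩ hX.toFinset).card := by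
    rintro e ⟨v, hv, hvX⟩
    exact Finset.card_pos.2 ⟨v, by simp [hv, hvX]⟩
  have hnot : ∀ e : edges T, (∃ v ∈ e.1, v ∉ X) ↔ (e.1 ∩ hX.toFinset).card < 2 := by
    intro e
    rw [← card_of_mem_edges e.2]
    constructor
    · rintro ⟨v, hv, hvX⟩
      exact Finset.card_lt_card ((Finset.ssubset_iff_of_subset Finset.inter_subset_left).2
        ⟨v, hv, by simp [hvX]⟩)
    · intro hlt
      obtain ⟨v, hv, hv'⟩ := Finset.exists_mem_notMem_of_card_lt_card hlt
      exact ⟨v, hv, by simpa [hv] using hv'⟩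
  -- In the sum of the boundary over `X`, an edge is counted once per end in `X`; modulo two only
  -- the cut edges survive.
  have h1 : ∑ v ∈ hX.toFinset, bdry₁ T c v = 0 := by simp [hc]
  have h2 : ∑ v ∈ hX.toFinset, bdry₁ T c v = ∑ e : edges T, (e.1 ∩ hX.toFinset).card • c e := by
    simp only [bdry₁_apply]
    rw [Finset.sum_comm]
    refine Finset.sum_congr rfl fun e _ => ?_
    rw [← Finset.sum_filter, Finset.sum_const]
    congr 2
    ext v
    simp [and_comm]
  rw [h2, Finset.sum_eq_single ε] at h1
  · have h3 := hmem ε hε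
    have h4 := (hnot ε).1 hε'
    rwa [show (ε.1 ∩ hX.toFinset).card = 1 by omega, one_smul] at h1
  · intro e _ hne
    have := hle e
    interval_cases hk : (e.1 ∩ hX.toFinset).card
    · simp
    · rw [h e hne ?_ ((hnot e).2 (by omega)), smul_zero]
      obtain ⟨v, hv⟩ := Finset.card_pos.1 (by omega : 0 < (e.1 ∩ hX.toFinset).card)
      simp only [Finset.mem_inter, Set.Finite.mem_toFinset] at hv
      exact ⟨v, hv.1, hv.2⟩
    · rw [two_nsmul, CharTwo.add_self_eq_zero]
  · simp

theorem bdry₁_single {u v : W} (huv : (skeleton T).Adj u v) :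
    bdry₁ T (Pi.single ⟨_, huv.2⟩ 1) = Pi.single u 1 + Pi.single v 1 := by
  ext x
  rw [bdry₁_apply, Finset.sum_eq_single ⟨_, huv.2⟩]
  · have := huv.1
    by_cases h1 : x = u <;> by_cases h2 : x = v <;> simp_all
  · intro e _ he
    simp [he]
  · simp

/-- Any two vertices of a connected set `X` are the boundary of a 1-chain inside `X`. -/
theorem exists_chain_of_preconnected {X : Set W} (hX : ((skeleton T).induce X).Preconnected)
    {x y : W} (hx : x ∈ X) (hy : y ∈ X) :
    ∃ c : edges T → ZMod 2, bdry₁ T c = Pi.single x 1 + Pi.single y 1 ∧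
      ∀ e, c e ≠ 0 → ∀ v ∈ e.1, v ∈ X := by
  have key : ∀ x y : X, ((skeleton T).induce X).Walk x y →
      ∃ c : edges T → ZMod 2, bdry₁ T c = Pi.single x.1 1 + Pi.single y.1 1 ∧
      ∀ e, c e ≠ 0 → ∀ v ∈ e.1, v ∈ X := by
    intro x y p
    induction p with
    | nil => exact ⟨0, by rw [map_zero, chain_add_self], by simp⟩
    | @cons x x' y h p ih =>
      obtain ⟨c, hc, hcX⟩ := ih
      have h' : (skeleton T).Adj x.1 x'.1 := h
      refine ⟨Pi.single ⟨_, h'.2⟩ 1 + c, ?_, ?_⟩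
      · rw [map_add, bdry₁_single h', hc, add_assoc, ← add_assoc (Pi.single x'.1 1),
          chain_add_self, zero_add]
      · intro e he v hv
        by_cases hee : e = ⟨_, h'.2⟩
        · subst hee
          simp only [Finset.mem_insert, Finset.mem_singleton] at hv
          rcases hv with rfl | rfl <;> exact Subtype.coe_prop _
        · refine hcX e ?_ v hv
          simpa [hee] using he
  obtain ⟨p⟩ := hX ⟨x, hx⟩ ⟨y, hy⟩
  exact key _ _ p

/-! ### The first homology group -/

/-- The surface is connected, so a 2-cycle has the same coefficient on all triangles. -/
theorem IsClosedSurface.finrank_ker_bdry₂ (hT : IsClosedSurface T) :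
    Module.finrank (ZMod 2) (LinearMap.ker (bdry₂ T)) ≤ 1 := by
  refine finrank_le_one (⟨fun _ => 1, ?_⟩ : LinearMap.ker (bdry₂ T)) ?_
  · rw [LinearMap.mem_ker]
    ext e
    obtain ⟨t, t', -, -, -, h⟩ := hT.exists_cofaces e
    rw [h, CharTwo.add_self_eq_zero]; rfl
  · rintro ⟨f, hf⟩
    rw [LinearMap.mem_ker] at hf
    have hpre : ((skeleton T).induce Set.univ).Preconnected := by
      rw [← (SimpleGraph.induceUnivIso (skeleton T)).symm.preconnected_iff]
      exact hT.connected.preconnected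
    obtain ⟨α, hα⟩ := hT.exists_nearEq (f := f) hpre (by simp [hf])
    refine ⟨α, Subtype.ext (funext fun t => ?_)⟩
    have : t.1.Nonempty := by
      rw [← Finset.card_pos, hT.card_triangle t.1 t.2]; norm_num
    obtain ⟨v, hv⟩ := this
    simp [hα t v hv trivial]

variable [Fintype W]

/-- By connectedness, any two vertices together form a boundary, so the boundaries and a single
vertex `w` span all 0-chains. -/
theorem IsClosedSurface.card_sub_one_le (hT : IsClosedSurface T) :
    Fintype.card W ≤ Module.finrank (ZMod 2) (LinearMap.range (bdry₁ T)) + 1 := by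
  obtain ⟨w⟩ := hT.connected.nonempty
  set R := LinearMap.range (bdry₁ T) with hR
  have hadj : ∀ u v, (skeleton T).Adj u v →
      (Pi.single u 1 + Pi.single v 1 : W → ZMod 2) ∈ R :=
    fun u v huv => ⟨_, bdry₁_single huv⟩
  have hreach : ∀ u v, (skeleton T).Reachable u v →
      (Pi.single u 1 + Pi.single v 1 : W → ZMod 2) ∈ R := by
    rintro u v ⟨p⟩
    induction p with
    | nil => rw [chain_add_self]; exact R.zero_mem
    | @cons a b c h p ih =>
      have := R.add_mem (hadj _ _ h) ih
      rwa [add_assoc, ← add_assoc (Pi.single b 1), chain_add_self, zero_add] at this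
  have htop : R ⊔ Submodule.span (ZMod 2) {Pi.single w 1} = ⊤ := by
    rw [eq_top_iff]
    intro x _
    rw [← Finset.univ_sum_single x]
    refine Submodule.sum_mem _ fun v _ => ?_
    have h1 : (Pi.single v (x v) : W → ZMod 2) = x v • Pi.single v 1 := by
      rw [← Pi.single_smul]; simp
    rw [h1]
    refine Submodule.smul_mem _ _ ?_
    have h2 : (Pi.single v 1 : W → ZMod 2) =
        (Pi.single v 1 + Pi.single w 1) + Pi.single w 1 := by
      rw [add_assoc, chain_add_self, add_zero]
    rw [h2]
    exact Submodule.add_mem_sup (hreach _ _ (hT.connected.preconnected v w))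
      (Submodule.mem_span_singleton_self _)
  have h1 := Submodule.finrank_add_le_finrank_add_finrank R
    (Submodule.span (ZMod 2) {(Pi.single w 1 : W → ZMod 2)})
  rw [htop, finrank_top, Module.finrank_fintype_fun_eq_card] at h1
  have h2 := finrank_span_le_card (R := ZMod 2) ({(Pi.single w 1 : W → ZMod 2)} : Set _)
  simp only [Set.toFinset_card, Fintype.card_unique] at h2
  omega

/-- The first Betti number modulo two is at most the Euler genus. -/
theorem IsClosedSurface.finrank_cycles_le (hT : IsClosedSurface T) :
    (Module.finrank (ZMod 2) (LinearMap.ker (bdry₁ T)) : ℤ) ≤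
      Module.finrank (ZMod 2) (LinearMap.range (bdry₂ T)) + surfaceEulerGenus T := by
  -- Rank-nullity for both boundary maps; the bounds `h3` and `h4` each lose one, which gives the 2
  -- in `2 - χ`.
  have h1 := LinearMap.finrank_range_add_finrank_ker (bdry₁ T)
  have h2 := LinearMap.finrank_range_add_finrank_ker (bdry₂ T)
  have h3 := hT.card_sub_one_le
  have h4 := hT.finrank_ker_bdry₂
  simp only [Module.finrank_fintype_fun_eq_card, Fintype.card_coe] at h1 h2
  simp only [surfaceEulerGenus, eulerChar]
  omega

/-- Spaces of cycles, each of which is not spanned modulo boundaries by its successors, are at most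
as many as the Euler genus. -/
theorem IsClosedSurface.card_le_of_not_le (hT : IsClosedSurface T) {ι : Type*} [DecidableEq ι]
    (κ : ι → ℤ) (hκ : Function.Injective κ) (J : Finset ι)
    (Λ : ι → Submodule (ZMod 2) (edges T → ZMod 2))
    (hZ : ∀ j ∈ J, Λ j ≤ LinearMap.ker (bdry₁ T))
    (h : ∀ j ∈ J, ¬ Λ j ≤ LinearMap.range (bdry₂ T) ⊔ ⨆ i ∈ J, ⨆ (_ : κ j < κ i), Λ i) :
    (J.card : ℤ) ≤ surfaceEulerGenus T := by
  -- The spaces are added by decreasing `κ`. For an up-closed `K`, the successors of its minimum are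
  -- exactly its other elements, so each step raises the dimension.
  have key : ∀ K : Finset ι, K ⊆ J → (∀ i ∈ K, ∀ j ∈ J, κ i < κ j → j ∈ K) →
      K.card + Module.finrank (ZMod 2) (LinearMap.range (bdry₂ T)) ≤
      Module.finrank (ZMod 2) ↥(LinearMap.range (bdry₂ T) ⊔ ⨆ i ∈ K, Λ i) := by
    intro K
    induction K using Finset.induction_on_min_value κ with
    | empty =>
      intro _ _
      rw [Finset.card_empty, zero_add]
      exact Submodule.finrank_mono le_sup_left
    | insert a s has hmin ih =>
      intro hs hup
      have hsup : ∀ i ∈ s, ∀ j ∈ J, κ i < κ j → j ∈ s := by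
        intro i hi j hj hij
        have := hup i (Finset.mem_insert_of_mem hi) j hj hij
        rcases Finset.mem_insert.1 this with rfl | h
        · exact absurd (hmin i hi) (by omega)
        · exact h
      have h1 := ih ((Finset.subset_insert _ _).trans hs) hsup
      have h2 := h a (hs (Finset.mem_insert_self _ _))
      have h3 : (⨆ i ∈ J, ⨆ (_ : κ a < κ i), Λ i) = ⨆ i ∈ s, Λ i := by
        apply le_antisymm
        · refine iSup₂_le fun i hi => iSup_le fun hlt => ?_
          have := hup a (Finset.mem_insert_self _ _) i hi hlt
          rcases Finset.mem_insert.1 this with rfl | h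
          · exact absurd hlt (lt_irrefl _)
          · exact le_iSup₂_of_le i h le_rfl
        · refine iSup₂_le fun i hi => ?_
          have hne : κ a ≠ κ i := fun hh => has (hκ hh ▸ hi)
          exact le_iSup₂_of_le i (hs (Finset.mem_insert_of_mem hi))
            (le_iSup_of_le (lt_of_le_of_ne (hmin i hi) hne) le_rfl)
      rw [h3] at h2
      have h4 : LinearMap.range (bdry₂ T) ⊔ ⨆ i ∈ s, Λ i <
          LinearMap.range (bdry₂ T) ⊔ ⨆ i ∈ insert a s, Λ i := by
        rw [Finset.iSup_insert]
        refine lt_of_le_of_ne (sup_le_sup_left le_sup_right _) fun heq => h2 ?_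
        rw [heq]
        exact le_sup_of_le_right le_sup_left
      have h5 := Submodule.finrank_lt_finrank_of_lt h4
      rw [Finset.card_insert_of_notMem has]
      omega
  have h1 := key J le_rfl fun _ _ j hj _ => hj
  have h2 : LinearMap.range (bdry₂ T) ⊔ ⨆ i ∈ J, Λ i ≤ LinearMap.ker (bdry₁ T) := by
    refine sup_le ?_ (iSup₂_le hZ)
    rintro _ ⟨f, rfl⟩
    exact hT.bdry₁_bdry₂ f
  have h3 := Submodule.finrank_mono h2
  have h4 := hT.finrank_cycles_le
  omega

end Chains

/-! ### Minors -/

section Minors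

variable {U V W : Type*}

/-- The new branch set of `u` is the union of the branch sets of the vertices in `B u`; walks in `B
u` show that it is connected. -/
theorem IsMinor.trans {H : SimpleGraph U} {G : SimpleGraph V} {S : SimpleGraph W}
    (hHG : IsMinor H G) (hGS : IsMinor G S) : IsMinor H S := by
  obtain ⟨B, hB, hBd, hBa⟩ := hHG
  obtain ⟨N, hN, hNd, hNa⟩ := hGS
  refine ⟨fun u => ⋃ x ∈ B u, N x, fun u => ?_, fun u v huv => ?_, fun u v huv => ?_⟩
  · have key : ∀ x y : B u, (G.induce (B u)).Walk x y → ∃ s ⊆ ⋃ x ∈ B u, N x,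
        N x ⊆ s ∧ N y ⊆ s ∧ (S.induce s).Connected := by
      intro x y p
      induction p with
      | @nil x => exact ⟨N x, Set.subset_biUnion_of_mem x.2, le_rfl, le_rfl, hN x⟩
      | @cons x x' y h p ih =>
        obtain ⟨s, hs, hx, hy, hc⟩ := ih
        obtain ⟨a, ha, b, hb, hab⟩ := hNa _ _ h
        exact ⟨N x ∪ s, Set.union_subset (Set.subset_biUnion_of_mem x.2) hs,
          Set.subset_union_left, hy.trans Set.subset_union_right,
          SimpleGraph.connected_induce_union (hN x).preconnected hc.preconnected ha (hx hb) hab⟩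
    obtain ⟨x⟩ := (hB u).nonempty
    obtain ⟨w, hw⟩ := (hN x).nonempty
    refine SimpleGraph.induce_connected_of_patches w (Set.mem_biUnion x.2 hw) ?_
    intro v hv
    obtain ⟨y, hy, hvy⟩ := Set.mem_iUnion₂.1 hv
    obtain ⟨p⟩ := (hB u).preconnected x ⟨y, hy⟩
    obtain ⟨s, hs, hxs, hys, hc⟩ := key _ _ p
    exact ⟨s, hs, hxs hw, hys hvy, hc.preconnected _ _⟩
  · simp only [Set.disjoint_iUnion_left, Set.disjoint_iUnion_right]
    intro x hx y hy
    refine hNd y x ?_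
    rintro rfl
    exact Set.disjoint_left.1 (hBd u v huv) hy hx
  · obtain ⟨x, hx, y, hy, hxy⟩ := hBa u v huv
    obtain ⟨a, ha, b, hb, hab⟩ := hNa x y hxy
    exact ⟨a, Set.mem_biUnion hx ha, b, Set.mem_biUnion hy hb, hab⟩

/-- The order on `W` assigns the interior of each path to its smaller end, so every branch set is a
star of truncated paths, and the last edge of each path joins two branch sets. -/
theorem DrawsIn.isMinor [LinearOrder W] {G : SimpleGraph V} {S : SimpleGraph W}
    (h : DrawsIn G S) : IsMinor G S := by
  classical
  obtain ⟨f, P, hpath, -, hthru, hcross⟩ := h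
  let N : V → Set W := fun x =>
    {w | w = f x ∨ ∃ y, ∃ h : G.Adj x y, f x < f y ∧ w ∈ (P h).support ∧ w ≠ f y}
  refine ⟨N, fun x => ?_, fun x x' hne => ?_, ?_⟩
  · refine SimpleGraph.induce_connected_of_patches (f x) (Or.inl rfl) ?_
    rintro w (rfl | ⟨y, hxy, hlt, hw, hwy⟩)
    · exact ⟨{f x}, by simp [N], rfl, rfl, SimpleGraph.Reachable.refl _⟩
    · refine ⟨{z | z ∈ ((P hxy).takeUntil w hw).support}, ?_, by simp, by simp,
        (SimpleGraph.Walk.connected_induce_support _).preconnected _ _⟩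
      intro z hz
      refine Or.inr ⟨y, hxy, hlt, (P hxy).support_takeUntil_subset_support hw hz, ?_⟩
      rintro rfl
      exact SimpleGraph.Walk.endpoint_notMem_support_takeUntil (hpath hxy) hw hwy.symm hz
  · rw [Set.disjoint_left]
    rintro w (rfl | ⟨y, hxy, hlt, hw, hwy⟩) (hw' | ⟨y', hxy', hlt', hw', hwy'⟩)
    · exact hne (f.injective hw')
    · rcases hthru hxy' x hw' with h | h
      · exact hne h
      · exact hwy' (by rw [h])
    · subst hw'
      rcases hthru hxy x' hw with h | h
      · exact hne h.symm
      · exact hwy (by rw [h])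
    · by_cases hs : s(x, y) = s(x', y')
      · rcases Sym2.eq_iff.1 hs with ⟨h, -⟩ | ⟨rfl, rfl⟩
        · exact hne h
        · exact lt_asymm hlt hlt'
      · obtain ⟨z, rfl⟩ := hcross hxy hxy' hs w hw hw'
        rcases hthru hxy z hw with rfl | rfl
        · rcases hthru hxy' z hw' with rfl | rfl
          · exact hne rfl
          · exact hwy' rfl
        · exact hwy rfl
  · have key : ∀ x y, G.Adj x y → f x < f y → ∃ a ∈ N x, ∃ b ∈ N y, S.Adj a b := by
      intro x y hxy hlt
      have hnil : ¬ (P hxy).Nil := SimpleGraph.Walk.not_nil_of_ne hlt.ne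
      have hadj := SimpleGraph.Walk.adj_penultimate hnil
      exact ⟨(P hxy).penultimate, Or.inr ⟨y, hxy, hlt, (P hxy).getVert_mem_support _, hadj.ne⟩,
        f y, Or.inl rfl, hadj⟩
    intro x y hxy
    rcases lt_or_gt_of_ne (f.injective.ne hxy.ne) with hlt | hlt
    · exact key x y hxy hlt
    · obtain ⟨a, ha, b, hb, hab⟩ := key y x hxy.symm hlt
      exact ⟨b, hb, a, ha, hab.symm⟩

/-- In a connected graph, the branch sets of a minor model can be enlarged to a partition of the
vertex set. -/
theorem exists_partition_of_model [Finite V] [Nonempty U] {G : SimpleGraph V}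
    (hG : G.Preconnected) (B : U → Set V) (hB : ∀ u, (G.induce (B u)).Connected)
    (hd : ∀ u v, u ≠ v → Disjoint (B u) (B v)) :
    ∃ β : V → U, (∀ u, ∀ x ∈ B u, β x = u) ∧ ∀ u, (G.induce (β ⁻¹' {u})).Connected := by
  classical
  induction hn : (⋃ u, B u)ᶜ.ncard using Nat.strong_induction_on generalizing B with
  | _ n ih =>
  by_cases hcov : (⋃ u, B u) = Set.univ
  · have hx : ∀ x, ∃ u, x ∈ B u := fun x => Set.mem_iUnion.1 (hcov ▸ Set.mem_univ x)
    choose β hβ using hx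
    have huniq : ∀ u, ∀ x ∈ B u, β x = u := fun u x hx => by
      by_contra h
      exact Set.disjoint_left.1 (hd _ _ h) (hβ x) hx
    refine ⟨β, huniq, fun u => ?_⟩
    have : β ⁻¹' {u} = B u := by
      ext x
      exact ⟨fun h => by have := hβ x; rwa [show β x = u from h] at this, fun h => huniq u x h⟩
    rw [this]
    exact hB u
  · obtain ⟨y, hy⟩ := (Set.ne_univ_iff_exists_notMem _).1 hcov
    obtain ⟨u₀⟩ := ‹Nonempty U›
    obtain ⟨⟨x, hx⟩⟩ := (hB u₀).nonempty
    obtain ⟨p⟩ := hG x y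
    -- A walk to the uncovered vertex `y` leaves the union of the branch sets along `d`; the head of
    -- `d` joins the branch set that contains its tail.
    obtain ⟨d, -, hd1, hd2⟩ := p.exists_boundary_dart (⋃ u, B u) (Set.mem_iUnion_of_mem u₀ hx) hy
    obtain ⟨u, hu⟩ := Set.mem_iUnion.1 hd1
    have hd2' : ∀ v, d.snd ∉ B v := fun v h => hd2 (Set.mem_iUnion_of_mem v h)
    have hmono : ∀ v, B v ⊆ Function.update B u (B u ∪ {d.snd}) v := by
      intro v
      by_cases h : v = u
      · subst h; simp
      · simp [h]
    suffices h : (⋃ v, Function.update B u (B u ∪ {d.snd}) v)ᶜ.ncard < n ∧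
        (∀ v, (G.induce (Function.update B u (B u ∪ {d.snd}) v)).Connected) ∧
        ∀ v w, v ≠ w → Disjoint (Function.update B u (B u ∪ {d.snd}) v)
          (Function.update B u (B u ∪ {d.snd}) w) by
      obtain ⟨β, h1, h2⟩ := ih _ h.1 _ h.2.1 h.2.2 rfl
      exact ⟨β, fun v x hx => h1 v x (hmono v hx), h2⟩
    refine ⟨?_, ?_, ?_⟩
    · rw [← hn]
      refine Set.ncard_lt_ncard (Set.ssubset_iff_of_subset ?_ |>.2 ⟨d.snd, hd2, ?_⟩)
        (Set.toFinite _)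
      · exact Set.compl_subset_compl.2 (Set.iUnion_mono hmono)
      · exact fun h => h (Set.mem_iUnion_of_mem u (by simp))
    · intro v
      by_cases h : v = u
      · subst h
        rw [Function.update_self]
        exact SimpleGraph.connected_induce_union (hB v).preconnected
          SimpleGraph.Preconnected.of_subsingleton hu rfl d.adj
      · rw [Function.update_of_ne h]; exact hB v
    · intro v w hvw
      by_cases h : v = u
      · subst h
        rw [Function.update_self, Function.update_of_ne hvw.symm, Set.disjoint_union_left]
        exact ⟨hd _ _ hvw, Set.disjoint_singleton_left.2 (hd2' w)⟩
      · rw [Function.update_of_ne h]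
        by_cases h' : w = u
        · subst h'
          rw [Function.update_self, Set.disjoint_union_right]
          exact ⟨hd _ _ hvw, Set.disjoint_singleton_right.2 (hd2' v)⟩
        · rw [Function.update_of_ne h']; exact hd _ _ hvw

end Minors

/-! ### Grid minors of triangulated surfaces -/

section GridModel

variable {W : Type*} [DecidableEq W] {T : Finset (Finset W)}

/-- `ℓ` is a 1-chain that runs from `x` to `y` through `X` and then through `Y`, where `ε` is its
only edge between the two sets. -/
structure IsLift (X Y : Set W) (x y : W) (ℓ : edges T → ZMod 2) (ε : edges T) : Prop where
  bdry : bdry₁ T ℓ = Pi.single x 1 + Pi.single y 1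
  left : ∃ v ∈ ε.1, v ∈ X
  right : ∃ v ∈ ε.1, v ∈ Y
  apply_self : ℓ ε = 1
  subset : ∀ e, ℓ e ≠ 0 → ∀ v ∈ e.1, v ∈ X ∨ v ∈ Y
  inside : ∀ e, e ≠ ε → ℓ e ≠ 0 → (∀ v ∈ e.1, v ∈ X) ∨ (∀ v ∈ e.1, v ∈ Y)

/-- Concatenate a chain in `X` from `x` to `a`, the edge `ab`, and a chain in `Y` from `b` to `y`.
-/
theorem exists_isLift {X Y : Set W} (hX : ((skeleton T).induce X).Preconnected)
    (hY : ((skeleton T).induce Y).Preconnected) (hXY : Disjoint X Y)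
    (hadj : ∃ a ∈ X, ∃ b ∈ Y, (skeleton T).Adj a b) {x y : W} (hx : x ∈ X) (hy : y ∈ Y) :
    ∃ (ℓ : edges T → ZMod 2) (ε : edges T), IsLift X Y x y ℓ ε := by
  obtain ⟨a, ha, b, hb, hab⟩ := hadj
  obtain ⟨c, hc, hcX⟩ := exists_chain_of_preconnected hX hx ha
  obtain ⟨d, hd, hdY⟩ := exists_chain_of_preconnected hY hb hy
  have hcε : c ⟨_, hab.2⟩ = 0 := by
    by_contra h
    exact Set.disjoint_left.1 hXY (hcX _ h b (by simp)) hb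
  have hdε : d ⟨_, hab.2⟩ = 0 := by
    by_contra h
    exact Set.disjoint_left.1 hXY ha (hdY _ h a (by simp))
  have hin : ∀ e : edges T, e ≠ ⟨_, hab.2⟩ →
      (c + Pi.single ⟨_, hab.2⟩ 1 + d : edges T → ZMod 2) e ≠ 0 →
      (∀ v ∈ e.1, v ∈ X) ∨ (∀ v ∈ e.1, v ∈ Y) := by
    intro e he h
    by_cases hce : c e = 0
    · refine Or.inr (hdY e ?_)
      simpa [hce, he] using h
    · exact Or.inl (hcX e hce)
  refine ⟨c + Pi.single ⟨_, hab.2⟩ 1 + d, ⟨_, hab.2⟩, ?_, ⟨a, by simp, ha⟩, ⟨b, by simp, hb⟩,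
    by simp [hcε, hdε], ?_, hin⟩
  · rw [map_add, map_add, hc, hd, bdry₁_single hab]
    ext v
    have h1 := congrFun (chain_add_self (Pi.single a 1 : W → ZMod 2)) v
    have h2 := congrFun (chain_add_self (Pi.single b 1 : W → ZMod 2)) v
    simp only [Pi.add_apply, Pi.zero_apply] at h1 h2 ⊢
    linear_combination h1 + h2
  · intro e he v hv
    by_cases hee : e = ⟨_, hab.2⟩
    · subst hee
      simp only [Finset.mem_insert, Finset.mem_singleton] at hv
      rcases hv with rfl | rfl
      · exact Or.inl ha
      · exact Or.inr hb
    · exact (hin e hee he).imp (fun h => h v hv) fun h => h v hv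

theorem IsLift.apply_eq_zero {X Y : Set W} {x y : W} {ℓ : edges T → ZMod 2} {ε : edges T}
    (h : IsLift X Y x y ℓ ε) {e : edges T} {v : W} (hv : v ∈ e.1) (hX : v ∉ X) (hY : v ∉ Y) :
    ℓ e = 0 := by
  by_contra he
  exact (h.subset e he v hv).elim hX hY

/-- A model of the `n × n` grid in the 1-skeleton of a triangulated surface, with a root in each
branch set and a lift of each edge of the grid. -/
structure GridModel (T : Finset (Finset W)) (n : ℕ) where
  X : ℕ → ℕ → Set W
  root : ℕ → ℕ → W
  hl : ℕ → ℕ → edges T → ZMod 2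
  hε : ℕ → ℕ → edges T
  vl : ℕ → ℕ → edges T → ZMod 2
  vε : ℕ → ℕ → edges T
  conn : ∀ a b, a < n → b < n → ((skeleton T).induce (X a b)).Preconnected
  disj : ∀ a b a' b', a < n → b < n → a' < n → b' < n → ∀ v ∈ X a b, v ∈ X a' b' → a = a' ∧ b = b'
  hlift : ∀ a b, a + 1 < n → b < n →
    IsLift (X a b) (X (a + 1) b) (root a b) (root (a + 1) b) (hl a b) (hε a b)
  vlift : ∀ a b, a < n → b + 1 < n →
    IsLift (X a b) (X a (b + 1)) (root a b) (root a (b + 1)) (vl a b) (vε a b)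

/-! ### Faces of a grid model and the 2-chains that they bound -/

namespace GridModel

variable {n : ℕ} (M : GridModel T n)

/-- The lift of the 4-cycle with lower left corner `(a, b)`. -/
def face (a b : ℕ) : edges T → ZMod 2 :=
  M.hl a b + M.hl a (b + 1) + M.vl a b + M.vl (a + 1) b

variable {M}

theorem hl_eq_zero {a b p q : ℕ} (ha : a + 1 < n) (hb : b < n) (hp : p < n) (hq : q < n)
    {e : edges T} {v : W} (hv : v ∈ e.1) (hvX : v ∈ M.X p q)
    (h : ¬ ((p = a ∨ p = a + 1) ∧ q = b)) : M.hl a b e = 0 := by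
  refine (M.hlift a b ha hb).apply_eq_zero hv (fun h' => h ?_) (fun h' => h ?_)
  · have := M.disj p q a b hp hq (by omega) hb v hvX h'; omega
  · have := M.disj p q (a + 1) b hp hq ha hb v hvX h'; omega

theorem vl_eq_zero {a b p q : ℕ} (ha : a < n) (hb : b + 1 < n) (hp : p < n) (hq : q < n)
    {e : edges T} {v : W} (hv : v ∈ e.1) (hvX : v ∈ M.X p q)
    (h : ¬ (p = a ∧ (q = b ∨ q = b + 1))) : M.vl a b e = 0 := by
  refine (M.vlift a b ha hb).apply_eq_zero hv (fun h' => h ?_) (fun h' => h ?_)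
  · have := M.disj p q a b hp hq ha (by omega) v hvX h'; omega
  · have := M.disj p q a (b + 1) hp hq ha hb v hvX h'; omega

theorem face_eq_zero {a b p q : ℕ} (ha : a + 1 < n) (hb : b + 1 < n) (hp : p < n) (hq : q < n)
    {e : edges T} {v : W} (hv : v ∈ e.1) (hvX : v ∈ M.X p q)
    (h : ¬ ((p = a ∨ p = a + 1) ∧ (q = b ∨ q = b + 1))) : M.face a b e = 0 := by
  simp only [face, Pi.add_apply]
  rw [hl_eq_zero ha (by omega) hp hq hv hvX (by omega),
    hl_eq_zero ha hb hp hq hv hvX (by omega),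
    vl_eq_zero (by omega) hb hp hq hv hvX (by omega),
    vl_eq_zero ha hb hp hq hv hvX (by omega)]
  simp

theorem bdry₁_face {a b : ℕ} (ha : a + 1 < n) (hb : b + 1 < n) : bdry₁ T (M.face a b) = 0 := by
  simp only [face, map_add, (M.hlift a b ha (by omega)).bdry, (M.hlift a (b + 1) ha hb).bdry,
    (M.vlift a b (by omega) hb).bdry, (M.vlift (a + 1) b ha hb).bdry]
  ext v
  have h1 := congrFun (chain_add_self (Pi.single (M.root a b) 1 : W → ZMod 2)) v
  have h2 := congrFun (chain_add_self (Pi.single (M.root (a + 1) b) 1 : W → ZMod 2)) v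
  have h3 := congrFun (chain_add_self (Pi.single (M.root a (b + 1)) 1 : W → ZMod 2)) v
  have h4 := congrFun (chain_add_self (Pi.single (M.root (a + 1) (b + 1)) 1 : W → ZMod 2)) v
  simp only [Pi.add_apply, Pi.zero_apply] at h1 h2 h3 h4 ⊢
  linear_combination h1 + h2 + h3 + h4

/-- If the four faces around an inner vertex of the grid bound, then the vertex lies inside their
union. -/
theorem nearEq_four_faces [Finite W] (hT : IsClosedSurface T) {a b : ℕ} (ha : a + 2 < n)
    (hb : b + 2 < n) {f₁ f₂ f₃ f₄ : T → ZMod 2}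
    (hf : ∀ e : edges T, ∀ v ∈ e.1, v ∈ M.X (a + 1) (b + 1) →
      bdry₂ T f₁ e = M.face a b e ∧ bdry₂ T f₂ e = M.face (a + 1) b e ∧
      bdry₂ T f₃ e = M.face a (b + 1) e ∧ bdry₂ T f₄ e = M.face (a + 1) (b + 1) e)
    (h₁ : NearEq f₁ (M.X (a + 2) (b + 1)) 0) (h₂ : NearEq f₂ (M.X a (b + 1)) 0)
    (h₃ : NearEq f₃ (M.X (a + 1) b) 0) (h₄ : NearEq f₄ (M.X (a + 1) b) 0) :
    NearEq (f₁ + f₂ + f₃ + f₄) (M.X (a + 1) (b + 1)) 1 := by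
  -- Each of the four spokes at the vertex lies in two of the faces and cancels; the other eight
  -- lifts avoid its branch set.
  have hz : ∀ e : edges T, ∀ v ∈ e.1, v ∈ M.X (a + 1) (b + 1) →
      bdry₂ T (f₁ + f₂ + f₃ + f₄) e = 0 := by
    intro e v hv hvX
    obtain ⟨e1, e2, e3, e4⟩ := hf e v hv hvX
    simp only [map_add, Pi.add_apply, e1, e2, e3, e4, face]
    have ho := fun p q hp hq => hl_eq_zero (M := M) (a := p) (b := q) hp hq
      (show a + 1 < n by omega) (show b + 1 < n by omega) hv hvX
    have ho' := fun p q hp hq => vl_eq_zero (M := M) (a := p) (b := q) hp hq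
      (show a + 1 < n by omega) (show b + 1 < n by omega) hv hvX
    rw [ho a b (by omega) (by omega) (by omega), ho (a + 1) b (by omega) (by omega) (by omega),
      ho a (b + 1 + 1) (by omega) (by omega) (by omega),
      ho (a + 1) (b + 1 + 1) (by omega) (by omega) (by omega),
      ho' a b (by omega) (by omega) (by omega), ho' a (b + 1) (by omega) (by omega) (by omega),
      ho' (a + 1 + 1) b (by omega) (by omega) (by omega),
      ho' (a + 1 + 1) (b + 1) (by omega) (by omega) (by omega)]
    linear_combination CharTwo.add_self_eq_zero (M.hl a (b + 1) e) +
      CharTwo.add_self_eq_zero (M.hl (a + 1) (b + 1) e) +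
      CharTwo.add_self_eq_zero (M.vl (a + 1) b e) +
      CharTwo.add_self_eq_zero (M.vl (a + 1) (b + 1) e)
  obtain ⟨c, hc⟩ := hT.exists_nearEq (M.conn (a + 1) (b + 1) (by omega) (by omega)) hz
  suffices hc1 : c = 1 by rwa [hc1] at hc
  have L1 := M.hlift a (b + 1) (by omega) (by omega)
  have L2 := M.vlift (a + 1) b (by omega) (by omega)
  have L3 := M.hlift (a + 1) (b + 1) (by omega) (by omega)
  obtain ⟨s, hs, hsX⟩ := L2.left
  obtain ⟨o, ho, hoX⟩ := L2.right
  -- The product is the overlap of the two lower 2-chains. Among the edges leaving the branch set,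
  -- `f₂` vanishes at the left spoke and `f₁` at the right one, and away from the spokes neither
  -- chain changes. Only the lower spoke remains, and a cycle cannot cross the cut once.
  have hcut : bdry₂ T (f₁ * f₂) (M.vε (a + 1) b) = 0 := by
    refine eq_zero_of_cut (hT.bdry₁_bdry₂ _) (M.X (a + 1) (b + 1)) _ L2.right ⟨s, hs, ?_⟩ ?_
    · intro h
      have := M.disj _ _ _ _ (by omega) (by omega) (by omega) (by omega) s hsX h
      omega
    · rintro e hne ⟨v, hv, hvX⟩ ⟨w, hw, hwX⟩
      obtain ⟨t, t', ht, ht', -, hall⟩ := hT.exists_cofaces e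
      rw [hall, Pi.mul_apply, Pi.mul_apply]
      by_cases he1 : e = M.hε a (b + 1)
      · obtain ⟨z, hz, hzX⟩ := L1.left
        rw [← he1] at hz
        rw [h₂ t z (ht hz) hzX, h₂ t' z (ht' hz) hzX]; simp
      by_cases he3 : e = M.hε (a + 1) (b + 1)
      · obtain ⟨z, hz, hzX⟩ := L3.right
        rw [← he3] at hz
        rw [h₁ t z (ht hz) hzX, h₁ t' z (ht' hz) hzX]; simp
      have hL1 : M.hl a (b + 1) e = 0 := by
        by_contra h
        rcases L1.inside e he1 h with h | h
        · have := M.disj _ _ _ _ (by omega) (by omega) (by omega) (by omega) v hvX (h v hv); omega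
        · exact hwX (h w hw)
      have hL2 : M.vl (a + 1) b e = 0 := by
        by_contra h
        rcases L2.inside e hne h with h | h
        · have := M.disj _ _ _ _ (by omega) (by omega) (by omega) (by omega) v hvX (h v hv); omega
        · exact hwX (h w hw)
      have hL3 : M.hl (a + 1) (b + 1) e = 0 := by
        by_contra h
        rcases L3.inside e he3 h with h | h
        · exact hwX (h w hw)
        · have := M.disj _ _ _ _ (by omega) (by omega) (by omega) (by omega) v hvX (h v hv); omega
      obtain ⟨e1, e2, -, -⟩ := hf e v hv hvX
      simp only [face, Pi.add_apply, hL1, hL2, hL3] at e1 e2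
      rw [hl_eq_zero (p := a + 1) (q := b + 1) (by omega) (by omega) (by omega) (by omega) hv hvX
          (by omega),
        vl_eq_zero (p := a + 1) (q := b + 1) (by omega) (by omega) (by omega) (by omega) hv hvX
          (by omega), hall] at e1
      rw [hl_eq_zero (p := a + 1) (q := b + 1) (by omega) (by omega) (by omega) (by omega) hv hvX
          (by omega),
        vl_eq_zero (p := a + 1) (q := b + 1) (by omega) (by omega) (by omega) (by omega) hv hvX
          (by omega), hall] at e2
      simp only [add_zero, CharTwo.add_eq_zero] at e1 e2
      rw [e1, e2, CharTwo.add_self_eq_zero]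
  obtain ⟨t, t', ht, ht', -, hall⟩ := hT.exists_cofaces (M.vε (a + 1) b)
  obtain ⟨e1, e2, -, -⟩ := hf _ o ho hoX
  simp only [face, Pi.add_apply, L2.apply_self] at e1 e2
  rw [hl_eq_zero (p := a + 1) (q := b + 1) (by omega) (by omega) (by omega) (by omega) ho hoX
      (by omega),
    hl_eq_zero (p := a + 1) (q := b) (by omega) (by omega) (by omega) (by omega) hs hsX
      (by omega),
    vl_eq_zero (p := a + 1) (q := b + 1) (by omega) (by omega) (by omega) (by omega) ho hoX
      (by omega), hall] at e1
  rw [hl_eq_zero (p := a + 1) (q := b + 1) (by omega) (by omega) (by omega) (by omega) ho hoX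
      (by omega),
    hl_eq_zero (p := a + 1) (q := b) (by omega) (by omega) (by omega) (by omega) hs hsX
      (by omega),
    vl_eq_zero (p := a + 1) (q := b + 1) (by omega) (by omega) (by omega) (by omega) ho hoX
      (by omega), hall] at e2
  have h5 := hc t o (ht ho) hoX
  simp only [Pi.add_apply] at h5
  rw [h₃ t s (ht hs) hsX, h₄ t s (ht hs) hsX] at h5
  rw [hall] at hcut
  simp only [Pi.mul_apply, add_zero, zero_add] at hcut h5 e1 e2
  -- Both lower chains change across the lower spoke. Were they equal on one side of it, they would
  -- overlap on exactly one side, contrary to `hcut`. So they differ there, while `f₃` and `f₄`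
  -- vanish.
  have hdec : ∀ x x' y y' c : ZMod 2, x + x' = 1 → y + y' = 1 → x + y = c →
      x * y + x' * y' = 0 → c = 1 := by decide
  exact hdec _ _ _ _ _ e1 e2 h5 hcut

end GridModel

end GridModel

/-! ### Blocks of a grid -/

section Blocks

theorem div_eq_and_mod_ne_zero {m i p : ℕ} (h : m * i < p) (h' : p < m * (i + 1)) :
    p / m = i ∧ p % m ≠ 0 := by
  obtain ⟨s, rfl⟩ := Nat.exists_eq_add_of_le h.le
  have hs : s < m := by rw [mul_add_one] at h'; omega
  have hm : 0 < m := by omega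
  rw [Nat.mul_add_div hm, Nat.div_eq_of_lt hs, Nat.mul_add_mod, Nat.mod_eq_of_lt hs]
  omega

/-- The vertices of the `n × n` grid that are not inside one of the blocks of side `m` given
by `L`. -/
def Free (n m : ℕ) (L : ℕ → ℕ → Prop) (p q : ℕ) : Prop :=
  p < n ∧ q < n ∧ ¬ (p % m ≠ 0 ∧ q % m ≠ 0 ∧ L (p / m) (q / m))

/-- A step back from a coordinate not divisible by `m` stays in the same block or lands on a line
between blocks, all of whose vertices are free. -/
theorem Free.of_succ_left {n m : ℕ} {L : ℕ → ℕ → Prop} {p q : ℕ} (h : Free n m L (p + 1) q)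
    (hp : (p + 1) % m ≠ 0) : Free n m L p q := by
  have hdvd : ¬ m ∣ p + 1 := fun h => hp (Nat.mod_eq_zero_of_dvd h)
  have h1 : (p + 1) / m = p / m := by rw [Nat.succ_div, if_neg hdvd, add_zero]
  exact ⟨by have := h.1; omega, h.2.1, fun ⟨_, h3, h4⟩ => h.2.2 ⟨hp, h3, h1 ▸ h4⟩⟩

theorem Free.of_succ_right {n m : ℕ} {L : ℕ → ℕ → Prop} {p q : ℕ} (h : Free n m L p (q + 1))
    (hq : (q + 1) % m ≠ 0) : Free n m L p q := by
  have hdvd : ¬ m ∣ q + 1 := fun h => hq (Nat.mod_eq_zero_of_dvd h)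
  have h1 : (q + 1) / m = q / m := by rw [Nat.succ_div, if_neg hdvd, add_zero]
  exact ⟨h.1, by have := h.2.1; omega, fun ⟨h2, _, h4⟩ => h.2.2 ⟨h2, hq, h1 ▸ h4⟩⟩

/-- The free vertices off a face of a block are connected in the grid. -/
theorem Free.induction {n m a b : ℕ} {L : ℕ → ℕ → Prop} {P : ℕ → ℕ → Prop}
    (ha : a % m ≠ 0) (ha' : (a + 1) % m ≠ 0) (hb : b % m ≠ 0) (hb' : (b + 1) % m ≠ 0)
    (h0 : P 0 0)
    (h1 : ∀ p q, Free n m L p q → ¬ ((p = a ∨ p = a + 1) ∧ (q = b ∨ q = b + 1)) →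
      Free n m L (p + 1) q → ¬ ((p + 1 = a ∨ p + 1 = a + 1) ∧ (q = b ∨ q = b + 1)) →
      P p q → P (p + 1) q)
    (h2 : ∀ p q, Free n m L p q → ¬ ((p = a ∨ p = a + 1) ∧ (q = b ∨ q = b + 1)) →
      Free n m L p (q + 1) → ¬ ((p = a ∨ p = a + 1) ∧ (q + 1 = b ∨ q + 1 = b + 1)) →
      P p q → P p (q + 1))
    {p q : ℕ} (h : Free n m L p q) (hpq : ¬ ((p = a ∨ p = a + 1) ∧ (q = b ∨ q = b + 1))) :
    P p q := by
  have hne : ∀ x, x % m = 0 → ¬ (x = a ∨ x = a + 1) ∧ ¬ (x = b ∨ x = b + 1) := by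
    rintro x hx
    refine ⟨?_, ?_⟩ <;> rintro (rfl | rfl) <;> contradiction
  have hl : ∀ p q, p < n → q < n → p % m = 0 → Free n m L p q :=
    fun p q hp hq h => ⟨hp, hq, fun h' => h'.1 h⟩
  have hr : ∀ p q, p < n → q < n → q % m = 0 → Free n m L p q :=
    fun p q hp hq h => ⟨hp, hq, fun h' => h'.2.1 h⟩
  -- The lines at multiples of `m` are free and miss the face, so `P` spreads over all of them from
  -- the origin.
  have hbot : ∀ p, p < n → P p 0 := by
    intro p
    induction p with
    | zero => exact fun _ => h0
    | succ p ih =>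
      intro hp
      have := (hne 0 (Nat.zero_mod m)).2
      exact h1 p 0 (hr _ _ (by omega) (by omega) (Nat.zero_mod m)) (by tauto)
        (hr _ _ hp (by omega) (Nat.zero_mod m)) (by tauto) (ih (by omega))
  have hleft : ∀ q, q < n → P 0 q := by
    intro q
    induction q with
    | zero => exact fun _ => h0
    | succ q ih =>
      intro hq
      have := (hne 0 (Nat.zero_mod m)).1
      exact h2 0 q (hl _ _ (by omega) (by omega) (Nat.zero_mod m)) (by tauto)
        (hl _ _ (by omega) hq (Nat.zero_mod m)) (by tauto) (ih (by omega))
  have hcol : ∀ p q, p < n → q < n → p % m = 0 → P p q := by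
    intro p q hp hq hpm
    induction q with
    | zero => exact hbot p hp
    | succ q ih =>
      have := (hne p hpm).1
      exact h2 p q (hl _ _ hp (by omega) hpm) (by tauto) (hl _ _ hp hq hpm) (by tauto)
        (ih (by omega))
  have hrow : ∀ p q, p < n → q < n → q % m = 0 → P p q := by
    intro p q hp hq hqm
    induction p with
    | zero => exact hleft q hq
    | succ p ih =>
      have := (hne q hqm).2
      exact h1 p q (hr _ _ (by omega) hq hqm) (by tauto) (hr _ _ hp hq hqm) (by tauto)
        (ih (by omega))
  -- A free vertex off the face misses its columns or its rows. Following its own row or column back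
  -- to a line between blocks therefore never meets the face.
  by_cases hp : p = a ∨ p = a + 1
  · have hq : ¬ (q = b ∨ q = b + 1) := by tauto
    clear hp hpq
    induction p with
    | zero => exact hleft q h.2.1
    | succ p ih =>
      by_cases hpm : (p + 1) % m = 0
      · exact hcol _ _ h.1 h.2.1 hpm
      · have h' := h.of_succ_left hpm
        exact h1 p q h' (by tauto) h (by tauto) (ih h')
  · clear hpq
    induction q with
    | zero => exact hbot p h.1
    | succ q ih =>
      by_cases hqm : (q + 1) % m = 0
      · exact hrow _ _ h.1 h.2.1 hqm
      · have h' := h.of_succ_right hqm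
        exact h2 p q h' (by tauto) h (by tauto) (ih h')

/-- The face with lower left corner `(a, b)` lies inside the block `(i, j)` of side `m`. -/
def FaceInBlock (m i j a b : ℕ) : Prop :=
  m * i < a ∧ a + 1 < m * (i + 1) ∧ m * j < b ∧ b + 1 < m * (j + 1)

variable {W : Type*} [DecidableEq W] {T : Finset (Finset W)} {n : ℕ} {M : GridModel T n}

/-- A bounding face of a block is the boundary of a 2-chain that vanishes near all free vertices
off the face. -/
theorem GridModel.exists_nearEq_zero (hT : IsClosedSurface T) {m i j a b : ℕ}
    {L : ℕ → ℕ → Prop} (hi : m * (i + 1) ≤ n) (hj : m * (j + 1) ≤ n)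
    (hab : FaceInBlock m i j a b) {f : T → ZMod 2}
    (hf : ∀ p q, Free n m L p q → ∀ e : edges T, ∀ v ∈ e.1, v ∈ M.X p q →
      bdry₂ T f e = M.face a b e) :
    ∃ g : T → ZMod 2, (∀ p q, Free n m L p q → ∀ e : edges T, ∀ v ∈ e.1, v ∈ M.X p q →
      bdry₂ T g e = M.face a b e) ∧
      ∀ p q, Free n m L p q → ¬ ((p = a ∨ p = a + 1) ∧ (q = b ∨ q = b + 1)) →
        NearEq g (M.X p q) 0 := by
  obtain ⟨ha, ha', hb, hb'⟩ := hab
  have hconst : ∀ (g : T → ZMod 2), (∀ p q, Free n m L p q → ∀ e : edges T, ∀ v ∈ e.1,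
      v ∈ M.X p q → bdry₂ T g e = M.face a b e) → ∀ p q, Free n m L p q →
      ¬ ((p = a ∨ p = a + 1) ∧ (q = b ∨ q = b + 1)) → ∃ α, NearEq g (M.X p q) α := by
    intro g hg p q hpq hne
    refine hT.exists_nearEq (M.conn p q hpq.1 hpq.2.1) fun e v hv hvX => ?_
    rw [hg p q hpq e v hv hvX]
    exact face_eq_zero (by omega) (by omega) hpq.1 hpq.2.1 hv hvX hne
  have h00 : Free n m L 0 0 := ⟨by omega, by omega, fun h => h.1 (Nat.zero_mod m)⟩
  obtain ⟨α, hα⟩ := hconst f hf 0 0 h00 (by omega)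
  -- A constant 2-chain is a cycle, so adding `α` normalises the value at the origin to 0 without
  -- changing the boundary.
  have hg : ∀ p q, Free n m L p q → ∀ e : edges T, ∀ v ∈ e.1, v ∈ M.X p q →
      bdry₂ T (f + fun _ => α) e = M.face a b e := by
    intro p q hpq e v hv hvX
    rw [← hf p q hpq e v hv hvX, map_add, Pi.add_apply]
    obtain ⟨t, t', -, -, -, h⟩ := hT.exists_cofaces e
    rw [h (fun _ => α), CharTwo.add_self_eq_zero, add_zero]
  refine ⟨f + fun _ => α, hg, fun p q hpq hne => ?_⟩
  refine Free.induction (L := L) (n := n) (P := fun p q => NearEq (f + fun _ => α) (M.X p q) 0)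
    (div_eq_and_mod_ne_zero ha (by omega)).2 (div_eq_and_mod_ne_zero (by omega) ha').2
    (div_eq_and_mod_ne_zero hb (by omega)).2 (div_eq_and_mod_ne_zero (by omega) hb').2
    ?_ ?_ ?_ hpq hne
  · intro t v hv hvX
    rw [Pi.add_apply, hα t v hv hvX, CharTwo.add_self_eq_zero]
  -- A triangle on the edge between two adjacent branch sets meets both, so their constants agree.
  · intro p q h1 h2 h3 h4 h5
    obtain ⟨γ, hγ⟩ := hconst _ hg _ _ h3 h4
    have hl := M.hlift p q h3.1 h3.2.1
    obtain ⟨x, hx, hxX⟩ := hl.left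
    obtain ⟨y, hy, hyX⟩ := hl.right
    obtain ⟨t, -, ht, -⟩ := hT.exists_cofaces (M.hε p q)
    rwa [← hγ t y (ht hy) hyX, h5 t x (ht hx) hxX] at hγ
  · intro p q h1 h2 h3 h4 h5
    obtain ⟨γ, hγ⟩ := hconst _ hg _ _ h3 h4
    have hl := M.vlift p q h3.1 h3.2.1
    obtain ⟨x, hx, hxX⟩ := hl.left
    obtain ⟨y, hy, hyX⟩ := hl.right
    obtain ⟨t, -, ht, -⟩ := hT.exists_cofaces (M.vε p q)
    rwa [← hγ t y (ht hy) hyX, h5 t x (ht hx) hxX] at hγ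

/-- If all faces of a block bound modulo cycles in blocks of `L`, then no edge jumps over a
concentric ring of that block and ends in a free vertex. -/
theorem GridModel.not_adj_of_bounding [Finite W] (hT : IsClosedSurface T) {r i j : ℕ}
    {L : ℕ → ℕ → Prop} (hi : 4 * r * (i + 1) ≤ n) (hj : 4 * r * (j + 1) ≤ n) (hL : ¬ L i j)
    (hf : ∀ a b, FaceInBlock (4 * r) i j a b → ∃ f : T → ZMod 2, ∀ p q, Free n (4 * r) L p q →
      ∀ e : edges T, ∀ v ∈ e.1, v ∈ M.X p q → bdry₂ T f e = M.face a b e)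
    {ρ u₁ u₂ v₁ v₂ : ℕ} (hρ : ρ ≤ r)
    (hu₁ : 4 * r * i + 2 * r < u₁ + ρ ∧ u₁ < 4 * r * i + 2 * r + ρ)
    (hu₂ : 4 * r * j + 2 * r < u₂ + ρ ∧ u₂ < 4 * r * j + 2 * r + ρ)
    (hv : ¬ (4 * r * i + 2 * r ≤ v₁ + ρ ∧ v₁ ≤ 4 * r * i + 2 * r + ρ ∧
      4 * r * j + 2 * r ≤ v₂ + ρ ∧ v₂ ≤ 4 * r * j + 2 * r + ρ))
    (hfree : Free n (4 * r) L v₁ v₂) {x y : W} (hx : x ∈ M.X u₁ u₂) (hy : y ∈ M.X v₁ v₂) :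
    ¬ (skeleton T).Adj x y := by
  intro hxy
  have hex : ∀ a b, ∃ g : T → ZMod 2, FaceInBlock (4 * r) i j a b →
      (∀ p q, Free n (4 * r) L p q → ∀ e : edges T, ∀ v ∈ e.1, v ∈ M.X p q →
      bdry₂ T g e = M.face a b e) ∧
      ∀ p q, Free n (4 * r) L p q → ¬ ((p = a ∨ p = a + 1) ∧ (q = b ∨ q = b + 1)) →
        NearEq g (M.X p q) 0 := by
    intro a b
    by_cases h : FaceInBlock (4 * r) i j a b
    · obtain ⟨f, hf⟩ := hf a b h
      obtain ⟨g, hg⟩ := GridModel.exists_nearEq_zero hT hi hj h hf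
      exact ⟨g, fun _ => hg⟩
    · exact ⟨0, fun h' => absurd h' h⟩
  choose g hg using hex
  have hblock : ∀ p q, 4 * r * i < p → p < 4 * r * (i + 1) → 4 * r * j < q →
      q < 4 * r * (j + 1) → Free n (4 * r) L p q := by
    intro p q h1 h2 h3 h4
    refine ⟨by omega, by omega, fun h => hL ?_⟩
    rw [← (div_eq_and_mod_ne_zero h1 h2).1, ← (div_eq_and_mod_ne_zero h3 h4).1]
    exact h.2.2
  have hi' := mul_add_one (4 * r) i
  have hj' := mul_add_one (4 * r) j
  obtain ⟨p, rfl⟩ : ∃ p, u₁ = p + 1 := ⟨u₁ - 1, by omega⟩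
  obtain ⟨q, rfl⟩ : ∃ q, u₂ = q + 1 := ⟨u₂ - 1, by omega⟩
  set I := Finset.Ico (4 * r * i + 2 * r - ρ) (4 * r * i + 2 * r + ρ) with hI
  set J := Finset.Ico (4 * r * j + 2 * r - ρ) (4 * r * j + 2 * r + ρ) with hJ
  have hbox : ∀ a ∈ I, ∀ b ∈ J, FaceInBlock (4 * r) i j a b := by
    intro a ha b hb
    rw [hI, Finset.mem_Ico] at ha
    rw [hJ, Finset.mem_Ico] at hb
    refine ⟨?_, ?_, ?_, ?_⟩ <;> omega
  have hp : p ∈ I := by rw [hI, Finset.mem_Ico]; omega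
  have hp' : p + 1 ∈ I := by rw [hI, Finset.mem_Ico]; omega
  have hq : q ∈ J := by rw [hJ, Finset.mem_Ico]; omega
  have hq' : q + 1 ∈ J := by rw [hJ, Finset.mem_Ico]; omega
  obtain ⟨t, -, ht, -⟩ := hT.exists_cofaces ⟨_, hxy.2⟩
  have hxt : x ∈ t.1 := ht (by simp)
  have hyt : y ∈ t.1 := ht (by simp)
  -- The end `y` lies outside the ring, hence off every face within it.
  have hout : ∑ z ∈ I ×ˢ J, g z.1 z.2 t = 0 := by
    refine Finset.sum_eq_zero fun z hz => ?_
    obtain ⟨h1, h2⟩ := Finset.mem_product.1 hz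
    refine (hg _ _ (hbox _ h1 _ h2)).2 v₁ v₂ hfree ?_ t y hyt hy
    rw [hI, Finset.mem_Ico] at h1
    rw [hJ, Finset.mem_Ico] at h2
    omega
  have hinner := nearEq_four_faces hT (M := M) (a := p) (b := q) (by omega) (by omega)
    (f₁ := g p q) (f₂ := g (p + 1) q) (f₃ := g p (q + 1)) (f₄ := g (p + 1) (q + 1))
    (fun e v hv hvX => by
      have hF := hblock (p + 1) (q + 1) (by omega) (by omega) (by omega) (by omega)
      exact ⟨(hg _ _ (hbox _ hp _ hq)).1 _ _ hF e v hv hvX,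
        (hg _ _ (hbox _ hp' _ hq)).1 _ _ hF e v hv hvX,
        (hg _ _ (hbox _ hp _ hq')).1 _ _ hF e v hv hvX,
        (hg _ _ (hbox _ hp' _ hq')).1 _ _ hF e v hv hvX⟩)
    ((hg _ _ (hbox _ hp _ hq)).2 _ _ (hblock _ _ (by omega) (by omega) (by omega) (by omega))
      (by omega))
    ((hg _ _ (hbox _ hp' _ hq)).2 _ _ (hblock _ _ (by omega) (by omega) (by omega) (by omega))
      (by omega))
    ((hg _ _ (hbox _ hp _ hq')).2 _ _ (hblock _ _ (by omega) (by omega) (by omega) (by omega))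
      (by omega))
    ((hg _ _ (hbox _ hp' _ hq')).2 _ _ (hblock _ _ (by omega) (by omega) (by omega) (by omega))
      (by omega)) t x hxt hx
  -- At the inner end `x`, only the four faces around its grid vertex contribute to the same sum,
  -- and they contribute 1.
  rw [← Finset.sum_subset (s₁ := {p, p + 1} ×ˢ {q, q + 1}), Finset.sum_product, Finset.sum_pair
    (by omega), Finset.sum_pair (by omega), Finset.sum_pair (by omega)] at hout
  · simp only [Pi.add_apply] at hinner
    refine one_ne_zero (α := ZMod 2) ?_
    rw [← hinner, ← hout]
    ring
  · refine Finset.product_subset_product ?_ ?_ <;>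
    · intro z hz
      simp only [Finset.mem_insert, Finset.mem_singleton] at hz
      rcases hz with rfl | rfl <;> assumption
  · intro z hz hz'
    obtain ⟨h1, h2⟩ := Finset.mem_product.1 hz
    refine (hg _ _ (hbox _ h1 _ h2)).2 (p + 1) (q + 1)
      (hblock _ _ (by omega) (by omega) (by omega) (by omega)) ?_ t x hxt hx
    simp only [Finset.mem_product, Finset.mem_insert, Finset.mem_singleton] at hz'
    omega

/-- Disjoint blocks of a grid minor, each with an edge jumping over a concentric ring that ends
outside the later blocks, are at most as many as the Euler genus. -/
theorem GridModel.card_blocks_le [Fintype W] (hT : IsClosedSurface T) (M : GridModel T n) {r : ℕ}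
    (κ : ℕ × ℕ → ℤ) (hκ : Function.Injective κ) (J : Finset (ℕ × ℕ))
    (hJ : ∀ j ∈ J, 4 * r * (j.1 + 1) ≤ n ∧ 4 * r * (j.2 + 1) ≤ n)
    (h : ∀ j ∈ J, ∃ ρ u₁ u₂ v₁ v₂, ρ ≤ r ∧
      (4 * r * j.1 + 2 * r < u₁ + ρ ∧ u₁ < 4 * r * j.1 + 2 * r + ρ) ∧
      (4 * r * j.2 + 2 * r < u₂ + ρ ∧ u₂ < 4 * r * j.2 + 2 * r + ρ) ∧
      ¬ (4 * r * j.1 + 2 * r ≤ v₁ + ρ ∧ v₁ ≤ 4 * r * j.1 + 2 * r + ρ ∧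
        4 * r * j.2 + 2 * r ≤ v₂ + ρ ∧ v₂ ≤ 4 * r * j.2 + 2 * r + ρ) ∧
      Free n (4 * r) (fun a b => (a, b) ∈ J ∧ κ j < κ (a, b)) v₁ v₂ ∧
      ∃ x ∈ M.X u₁ u₂, ∃ y ∈ M.X v₁ v₂, (skeleton T).Adj x y) :
    (J.card : ℤ) ≤ surfaceEulerGenus T := by
  let Λ : ℕ × ℕ → Submodule (ZMod 2) (edges T → ZMod 2) := fun j =>
    Submodule.span (ZMod 2) {c | ∃ a b, FaceInBlock (4 * r) j.1 j.2 a b ∧ c = M.face a b}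
  refine hT.card_le_of_not_le κ hκ J Λ ?_ ?_
  · intro j hj
    refine Submodule.span_le.2 ?_
    rintro _ ⟨a, b, ⟨-, h1, -, h2⟩, rfl⟩
    have := hJ j hj
    exact M.bdry₁_face (by omega) (by omega)
  · intro j hj hle
    obtain ⟨ρ, u₁, u₂, v₁, v₂, hρ, hu₁, hu₂, hv, hfree, x, hx, y, hy, hxy⟩ := h j hj
    refine M.not_adj_of_bounding hT (hJ j hj).1 (hJ j hj).2 (fun hh => lt_irrefl _ hh.2)
      ?_ hρ hu₁ hu₂ hv hfree hx hy hxy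
    intro a b hab
    obtain ⟨_, ⟨f, rfl⟩, d, hd, hfd⟩ := Submodule.mem_sup.1
      (hle (Submodule.subset_span ⟨a, b, hab, rfl⟩ : M.face a b ∈ Λ j))
    refine ⟨f, fun p q hpq e v hv hvX => ?_⟩
    suffices hde : d e = 0 by rw [← hfd, Pi.add_apply, hde, add_zero]
    -- Faces inside later blocks vanish on every edge that meets the branch set of a free vertex.
    suffices hle : (⨆ i ∈ J, ⨆ (_ : κ j < κ i), Λ i) ≤
        LinearMap.ker (LinearMap.proj (R := ZMod 2) (φ := fun _ : edges T => ZMod 2) e) from hle hd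
    refine iSup₂_le fun i hi => iSup_le fun hlt => Submodule.span_le.2 ?_
    rintro _ ⟨a, b, ⟨h1, h2, h3, h4⟩, rfl⟩
    have := hJ i hi
    refine M.face_eq_zero (by omega) (by omega) hpq.1 hpq.2.1 hv hvX fun hin => hpq.2.2 ?_
    obtain ⟨h5, h6⟩ := div_eq_and_mod_ne_zero (m := 4 * r) (i := i.1) (p := p)
      (by omega) (by omega)
    obtain ⟨h7, h8⟩ := div_eq_and_mod_ne_zero (m := 4 * r) (i := i.2) (p := q)
      (by omega) (by omega)
    exact ⟨h6, h8, by rw [h5, h7]; exact ⟨hi, hlt⟩⟩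

end Blocks

/-! ### Graphs of bounded radius -/

section Radius

/-- The model comes from a supergraph `H` of the grid, so that the jumping edges, which are not grid
edges, are also realised between branch sets. -/
theorem IsClosedSurface.exists_gridModel {W : Type*} [DecidableEq W] {T : Finset (Finset W)}
    (hT : IsClosedSurface T) {n : ℕ} {H : SimpleGraph (Fin n × Fin n)} (hle : grid n n ≤ H)
    (hH : IsMinor H (skeleton T)) :
    ∃ M : GridModel T n, ∀ p q : Fin n × Fin n, H.Adj p q →
      ∃ x ∈ M.X p.1 p.2, ∃ y ∈ M.X q.1 q.2, (skeleton T).Adj x y := by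
  obtain ⟨B, hB, hBd, hBa⟩ := hH
  -- The vertex `w₀` and the edge `e₀` are default values for indices outside the grid.
  obtain ⟨w₀⟩ := hT.connected.nonempty
  obtain ⟨t₀, ht₀, hw₀⟩ := hT.exists_triangle w₀
  obtain ⟨e₀, he₀, hcard⟩ := Finset.exists_subset_card_eq
    (show 2 ≤ t₀.card by rw [hT.card_triangle t₀ ht₀]; norm_num)
  have hE : e₀ ∈ edges T := mem_edges.2 ⟨t₀, ht₀, he₀, hcard⟩
  let X : ℕ → ℕ → Set W := fun a b => {w | ∃ (ha : a < n) (hb : b < n), w ∈ B (⟨a, ha⟩, ⟨b, hb⟩)}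
  have hX : ∀ p : Fin n × Fin n, X p.1 p.2 = B p := by
    intro p
    ext w
    simp [X]
  have hconn : ∀ a b, a < n → b < n → ((skeleton T).induce (X a b)).Connected := by
    intro a b ha hb
    rw [hX (⟨a, ha⟩, ⟨b, hb⟩)]
    exact hB _
  have hdisj : ∀ a b a' b', a < n → b < n → a' < n → b' < n →
      ∀ v ∈ X a b, v ∈ X a' b' → a = a' ∧ b = b' := by
    rintro a b a' b' - - - - v ⟨ha, hb, hv⟩ ⟨ha', hb', hv'⟩
    by_contra h
    refine Set.disjoint_left.1 (hBd _ _ ?_) hv hv'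
    intro heq
    rw [Prod.ext_iff, Fin.ext_iff, Fin.ext_iff] at heq
    exact h heq
  have hadj : ∀ p q : Fin n × Fin n, H.Adj p q →
      ∃ x ∈ X p.1 p.2, ∃ y ∈ X q.1 q.2, (skeleton T).Adj x y := by
    intro p q hpq
    rw [hX, hX]
    exact hBa p q hpq
  have hroot : ∀ a b, ∃ w, a < n → b < n → w ∈ X a b := by
    intro a b
    by_cases h : a < n ∧ b < n
    · obtain ⟨w⟩ := (hconn a b h.1 h.2).nonempty
      exact ⟨w.1, fun _ _ => w.2⟩
    · exact ⟨w₀, fun h1 h2 => absurd ⟨h1, h2⟩ h⟩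
  choose root hroot using hroot
  have hlift : ∀ a b, ∃ (ℓ : edges T → ZMod 2) (ε : edges T), a + 1 < n → b < n →
      IsLift (X a b) (X (a + 1) b) (root a b) (root (a + 1) b) ℓ ε := by
    intro a b
    by_cases h : a + 1 < n ∧ b < n
    · obtain ⟨ℓ, ε, hℓ⟩ := exists_isLift (hconn a b (by omega) h.2).preconnected
        (hconn (a + 1) b h.1 h.2).preconnected
        (Set.disjoint_left.2 fun v hv hv' => by
          have := hdisj a b (a + 1) b (by omega) h.2 h.1 h.2 v hv hv'; omega)
        (hadj (⟨a, by omega⟩, ⟨b, h.2⟩) (⟨a + 1, h.1⟩, ⟨b, h.2⟩) (hle (by simp [grid])))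
        (hroot a b (by omega) h.2) (hroot (a + 1) b h.1 h.2)
      exact ⟨ℓ, ε, fun _ _ => hℓ⟩
    · exact ⟨0, ⟨e₀, hE⟩, fun h1 h2 => absurd ⟨h1, h2⟩ h⟩
  have vlift : ∀ a b, ∃ (ℓ : edges T → ZMod 2) (ε : edges T), a < n → b + 1 < n →
      IsLift (X a b) (X a (b + 1)) (root a b) (root a (b + 1)) ℓ ε := by
    intro a b
    by_cases h : a < n ∧ b + 1 < n
    · obtain ⟨ℓ, ε, hℓ⟩ := exists_isLift (hconn a b h.1 (by omega)).preconnected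
        (hconn a (b + 1) h.1 h.2).preconnected
        (Set.disjoint_left.2 fun v hv hv' => by
          have := hdisj a b a (b + 1) h.1 (by omega) h.1 h.2 v hv hv'; omega)
        (hadj (⟨a, h.1⟩, ⟨b, by omega⟩) (⟨a, h.1⟩, ⟨b + 1, h.2⟩) (hle (by simp [grid])))
        (hroot a b h.1 (by omega)) (hroot a (b + 1) h.1 h.2)
      exact ⟨ℓ, ε, fun _ _ => hℓ⟩
    · exact ⟨0, ⟨e₀, hE⟩, fun h1 h2 => absurd ⟨h1, h2⟩ h⟩
  choose hl hε hlift using hlift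
  choose vl vε vlift using vlift
  exact ⟨⟨X, root, hl, hε, vl, vε, fun a b ha hb => (hconn a b ha hb).preconnected, hdisj, hlift,
    vlift⟩, hadj⟩

/-- A function that grows by at most one along edges until it reaches `r` grows by at most the
length of a walk. -/
theorem le_add_length_of_adj {V : Type*} {G : SimpleGraph V} {r : ℕ} {d : V → ℕ}
    (hd : ∀ x y, G.Adj x y → d x < r → d y ≤ d x + 1) {a b : V} (p : G.Walk a b)
    (hp : d a + p.length ≤ r) : d b ≤ d a + p.length := by
  induction p with
  | nil => simp
  | cons h p ih =>
    rw [SimpleGraph.Walk.length_cons] at hp ⊢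
    have h1 := hd _ _ h (by omega)
    have h2 := ih (by omega)
    omega

/-- Rounding `n / (4r)` down loses less than one, which the summand 1 in the bound absorbs; squaring
then counts the blocks. -/
theorem lt_div_of_ceil {g r n : ℕ} (hr : 1 ≤ r)
    (hn : 4 * (r : ℝ) * (1 + √(2 * (g : ℝ) + 2)) ≤ n) :
    2 * g + 2 < n / (4 * r) * (n / (4 * r)) := by
  have h1 : n < 4 * r * (n / (4 * r) + 1) := Nat.lt_mul_div_succ n (by omega)
  have h2 : (n : ℝ) < 4 * r * ((n / (4 * r) : ℕ) + 1) := by exact_mod_cast h1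
  have hr0 : (0 : ℝ) < 4 * r := by positivity
  have h3 : √(2 * (g : ℝ) + 2) < (n / (4 * r) : ℕ) := by
    have := lt_of_mul_lt_mul_left (hn.trans_lt h2) hr0.le
    linarith
  rw [Real.sqrt_lt' ((Real.sqrt_nonneg _).trans_lt h3)] at h3
  have h4 : ((2 * g + 2 : ℕ) : ℝ) < ((n / (4 * r) * (n / (4 * r)) : ℕ) : ℝ) := by
    rw [Nat.cast_mul, ← pow_two]
    push_cast
    exact_mod_cast h3
  exact_mod_cast h4

/-- A vertex far from the centre of a block of a grid minor is reached by an edge that jumps over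
a concentric ring of the block. -/
theorem exists_jump {V : Type*} {G : SimpleGraph V} {n r i j : ℕ} {β : V → Fin n × Fin n}
    {x z : V} (hx : ((β x).1 : ℕ) = 4 * r * i + 2 * r ∧ ((β x).2 : ℕ) = 4 * r * j + 2 * r)
    (hr : 1 ≤ r) (hz : ¬ (((β z).1 : ℕ) / (4 * r) = i ∧ ((β z).2 : ℕ) / (4 * r) = j))
    (p : G.Walk x z) (hp : p.length ≤ r) :
    ∃ u v ρ, G.Adj u v ∧ ρ ≤ r ∧
      (4 * r * i + 2 * r < (β u).1 + ρ ∧ (β u).1 < 4 * r * i + 2 * r + ρ) ∧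
      (4 * r * j + 2 * r < (β u).2 + ρ ∧ (β u).2 < 4 * r * j + 2 * r + ρ) ∧
      ¬ (4 * r * i + 2 * r ≤ (β v).1 + ρ ∧ (β v).1 ≤ 4 * r * i + 2 * r + ρ ∧
        4 * r * j + 2 * r ≤ (β v).2 + ρ ∧ (β v).2 ≤ 4 * r * j + 2 * r + ρ) := by
  by_contra hno
  -- Sup-distance in the grid from the middle of the block to the part of `y`.
  let d : V → ℕ := fun y => max (((β y).1 : ℤ) - (4 * r * i + 2 * r : ℕ)).natAbs
    (((β y).2 : ℤ) - (4 * r * j + 2 * r : ℕ)).natAbs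
  have hdx : d x = 0 := by
    simp only [d, hx.1, hx.2]
    simp
  have hstep : ∀ u v, G.Adj u v → d u < r → d v ≤ d u + 1 := by
    intro u v huv hur
    by_contra hlt
    -- The ring of radius `d u + 1` is the one jumped over.
    refine hno ⟨u, v, d u + 1, huv, hur, ?_, ?_, ?_⟩ <;> simp only [d] at * <;> omega
  have hdz := le_add_length_of_adj hstep p (by omega)
  rw [hdx, zero_add] at hdz
  have hi := mul_add_one (4 * r) i
  have hj := mul_add_one (4 * r) j
  have h1 : d z ≤ r := hdz.trans hp
  simp only [d] at h1
  exact hz ⟨(div_eq_and_mod_ne_zero (by omega) (by omega)).1,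
    (div_eq_and_mod_ne_zero (by omega) (by omega)).1⟩

end Radius

end SurfaceGrid

/-! ### Counting the blocks -/

open SurfaceGrid in
theorem mainTheorem4 {V : Type*} [Finite V] (G : SimpleGraph V) (g r : ℕ)
    (hg : SurfaceGrid.eulerGenus G = (g : ℕ∞)) (hr : G.radius = (r : ℕ∞)) (hr1 : 1 ≤ r) :
    ¬ SurfaceGrid.IsMinor
      (SurfaceGrid.grid ⌈4 * (r : ℝ) * (1 + √(2 * (g : ℝ) + 2))⌉₊
        ⌈4 * (r : ℝ) * (1 + √(2 * (g : ℝ) + 2))⌉₊) G := by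
  have hn := lt_div_of_ceil hr1 (Nat.le_ceil (4 * (r : ℝ) * (1 + √(2 * (g : ℝ) + 2))))
  generalize ⌈4 * (r : ℝ) * (1 + √(2 * (g : ℝ) + 2))⌉₊ = n at hn ⊢
  rintro ⟨B, hB, hBd, hBa⟩
  obtain ⟨k, hk, hkg⟩ : ∃ k, EmbedsInSurfaceOfEulerGenus G k ∧ k ≤ g := by
    have h : eulerGenus G < ((g + 1 : ℕ) : ℕ∞) := by
      rw [hg]; exact_mod_cast Nat.lt_succ_self g
    simp only [eulerGenus, iInf_lt_iff] at h
    obtain ⟨k, hk, hlt⟩ := h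
    exact ⟨k, hk, Nat.lt_succ_iff.1 (by exact_mod_cast hlt)⟩
  obtain ⟨N, T, hT, hgenus, hdraw⟩ := hk
  obtain ⟨z, hz⟩ : ∃ z, ∀ x, ∃ p : G.Walk z x, p.length ≤ r := by
    have h : G.radius < ((r + 1 : ℕ) : ℕ∞) := by
      rw [hr]; exact_mod_cast Nat.lt_succ_self r
    simp only [SimpleGraph.radius, iInf_lt_iff] at h
    obtain ⟨z, hz⟩ := h
    refine ⟨z, fun x => ?_⟩
    have h1 : G.edist z x < ((r + 1 : ℕ) : ℕ∞) := SimpleGraph.edist_le_eccent.trans_lt hz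
    obtain ⟨p, hp⟩ := SimpleGraph.exists_walk_of_edist_ne_top (ne_top_of_lt h1)
    rw [← hp] at h1
    exact ⟨p, Nat.lt_succ_iff.1 (by exact_mod_cast h1)⟩
  have hnpos : 0 < n := by
    rcases Nat.eq_zero_or_pos n with h | h
    · subst h; simp at hn
    · exact h
  have : Nonempty (Fin n × Fin n) := ⟨(⟨0, hnpos⟩, ⟨0, hnpos⟩)⟩
  have hpre : G.Preconnected := fun x y =>
    ((hz x).choose.reachable.symm).trans (hz y).choose.reachable
  obtain ⟨β, hβB, hβ⟩ := exists_partition_of_model hpre B hB hBd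
  let H : SimpleGraph (Fin n × Fin n) := SimpleGraph.fromRel fun p q =>
    ∃ x y, β x = p ∧ β y = q ∧ G.Adj x y
  have hHadj : ∀ p q, H.Adj p q → ∃ x y, β x = p ∧ β y = q ∧ G.Adj x y := by
    rintro p q ⟨-, h | ⟨x, y, hx, hy, hxy⟩⟩
    · exact h
    · exact ⟨y, x, hy, hx, hxy.symm⟩
  have hle : grid n n ≤ H := by
    intro p q hpq
    obtain ⟨x, hx, y, hy, hxy⟩ := hBa p q hpq
    exact ⟨hpq.ne, Or.inl ⟨x, y, hβB p x hx, hβB q y hy, hxy⟩⟩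
  have hHG : IsMinor H G := by
    refine ⟨fun p => β ⁻¹' {p}, hβ, fun p q hpq => ?_, fun p q hpq => ?_⟩
    · exact Disjoint.preimage _ (Set.disjoint_singleton.2 hpq)
    · obtain ⟨x, y, hx, hy, hxy⟩ := hHadj p q hpq
      exact ⟨x, hx, y, hy, hxy⟩
  obtain ⟨M, hM⟩ := hT.exists_gridModel hle (hHG.trans hdraw.isMinor)
  set m := 4 * r with hm
  -- All blocks except one that contains the centre `z`: from the others, the walk to `z` has to
  -- leave the block.
  set D := (Finset.range (n / m) ×ˢ Finset.range (n / m)).erase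
    (((β z).1 : ℕ) / m, ((β z).2 : ℕ) / m) with hD
  have hDcard : 2 * g + 1 < D.card := by
    have := Finset.pred_card_le_card_erase (s := Finset.range (n / m) ×ˢ Finset.range (n / m))
      (a := (((β z).1 : ℕ) / m, ((β z).2 : ℕ) / m))
    rw [Finset.card_product, Finset.card_range, ← hD] at this
    omega
  have hDn : ∀ j ∈ D, m * (j.1 + 1) ≤ n ∧ m * (j.2 + 1) ≤ n := by
    intro j hj
    obtain ⟨h1, h2⟩ := Finset.mem_product.1 (Finset.mem_of_mem_erase hj)
    rw [Finset.mem_range] at h1 h2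
    exact ⟨(Nat.mul_le_mul_left m h1).trans (Nat.mul_div_le n m),
      (Nat.mul_le_mul_left m h2).trans (Nat.mul_div_le n m)⟩
  have hjump : ∀ j ∈ D, ∃ v₁ v₂, v₁ < n ∧ v₂ < n ∧ ∃ ρ u₁ u₂, ρ ≤ r ∧
      (m * j.1 + 2 * r < u₁ + ρ ∧ u₁ < m * j.1 + 2 * r + ρ) ∧
      (m * j.2 + 2 * r < u₂ + ρ ∧ u₂ < m * j.2 + 2 * r + ρ) ∧
      ¬ (m * j.1 + 2 * r ≤ v₁ + ρ ∧ v₁ ≤ m * j.1 + 2 * r + ρ ∧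
        m * j.2 + 2 * r ≤ v₂ + ρ ∧ v₂ ≤ m * j.2 + 2 * r + ρ) ∧
      ∃ x ∈ M.X u₁ u₂, ∃ y ∈ M.X v₁ v₂, (skeleton T).Adj x y := by
    intro j hj
    have h1 := hDn j hj
    rw [mul_add_one, mul_add_one] at h1
    obtain ⟨x⟩ := (hB (⟨m * j.1 + 2 * r, by omega⟩, ⟨m * j.2 + 2 * r, by omega⟩)).nonempty
    have hx := hβB _ x.1 x.2
    obtain ⟨p, hp⟩ := hz x
    obtain ⟨u, v, ρ, huv, hρ, hu₁, hu₂, hv⟩ := exists_jump (G := G) (β := β) (x := x.1) (z := z)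
      (i := j.1) (j := j.2) (r := r) (by rw [hx]; exact ⟨rfl, rfl⟩) hr1
      (fun h => Finset.ne_of_mem_erase hj (Prod.ext h.1.symm h.2.symm))
      p.reverse (by rwa [SimpleGraph.Walk.length_reverse])
    refine ⟨(β v).1, (β v).2, (β v).1.2, (β v).2.2, ρ, (β u).1, (β u).2, hρ, hu₁, hu₂, hv, ?_⟩
    -- The two parts differ because one is inside the ring and the other outside.
    refine hM (β u) (β v) ⟨fun h => hv ?_, Or.inl ⟨u, v, rfl, rfl, huv⟩⟩
    rw [← h]
    omega
  choose! v₁ v₂ hv₁ hv₂ hv using hjump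
  let κ : ℕ × ℕ → ℤ := fun p => (Nat.pair p.1 p.2 : ℤ)
  have hκ : Function.Injective κ := by
    intro p q hpq
    have := Nat.pair_eq_pair.1 (Nat.cast_injective hpq)
    exact Prod.ext this.1 this.2
  -- The order is left open so that it can be used with `κ` and with `-κ`. A jump that ends in its
  -- own block, or in an earlier one, ends in a free vertex.
  have hcount : ∀ (κ' : ℕ × ℕ → ℤ), Function.Injective κ' → ∀ J ⊆ D,
      (∀ j ∈ J, κ' (v₁ j / m, v₂ j / m) ≤ κ' j) → J.card ≤ g := by
    intro κ' hκ' J hJ hle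
    have h := M.card_blocks_le hT (r := r) κ' hκ' J (fun j hj => hDn j (hJ hj)) (fun j hj => by
      obtain ⟨ρ, u₁, u₂, h1, h2, h3, h4, h5⟩ := hv j (hJ hj)
      exact ⟨ρ, u₁, u₂, v₁ j, v₂ j, h1, h2, h3, h4,
        ⟨hv₁ j (hJ hj), hv₂ j (hJ hj), fun h => absurd h.2.2.2 (hle j hj).not_gt⟩, h5⟩)
    omega
  have h1 := hcount κ hκ (D.filter fun j => κ (v₁ j / m, v₂ j / m) ≤ κ j)
    (Finset.filter_subset _ _) (fun j hj => (Finset.mem_filter.1 hj).2)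
  have h2 := hcount (fun p => - κ p) (neg_injective.comp hκ)
    (D.filter fun j => ¬ κ (v₁ j / m, v₂ j / m) ≤ κ j) (Finset.filter_subset _ _)
    (fun j hj => by have := (Finset.mem_filter.1 hj).2; omega)
  have h3 := Finset.card_filter_add_card_filter_not (s := D)
    (fun j => κ (v₁ j / m, v₂ j / m) ≤ κ j)
  omega
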